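/- Let $\Bbbk$ be a field of characteristic zero. Definitions. Graded means $\mathbb Z$-graded; $\epsilon(\pi)$ is the Koszul sign of a partition $\pi=B_1\sqcup\cdots\sqcup B_{|\pi|}$ of $[n]$ (blocks ordered by their greatest elements), $P(n)$ is the set of all these partitions, $\epsilon(\pi,i)=\epsilon(\pi)(-1)^{|x_{B_1}|+\cdots+|x_{B_{i-1}}|}$, and $f(x_B)=f_r(x_{j_1},\dots,x_{j_r})$ for $B=\{j_1<\dots<j_r\}$. A homotopy probability algebra $\mathcal C_C=(\mathcal C,\underline M,K)$ is a graded vector space $\mathcal C$ with a unit $1_{\mathcal C}$ of degree $0$, a differential $K$ of degree $1$ with $K^2=0$, $K1_{\mathcal C}=0$, $1_{\mathcal C}\notin\operatorname{Im}K$, and degree $0$ linear maps $M_n:S^n\mathcal C\to\mathcal C$ $(n\ge1)$ with $M_1=I$ and $M_{n+1}(x_1,\dots,x_n,1_{\mathcal C})=M_n(x_1,\dots,x_n)$ (a correlation algebra). A morphism is a degree $0$ cochain map preserving units. The descendant $(\mathcal C,\underline\ell^K)$ is defined recursively by $$KM_n(x_1,\dots,x_n)=\sum_{\pi\in P(n),\,|B_i|=n-|\pi|+1}\epsilon(\pi,i)\,M_{|\pi|}\big(x_{B_1},\dots,\ell^K(x_{B_i}),\dots,x_{B_{|\pi|}}\big).$$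 Let $\underline\Lambda$ be a family of degree $-1$ linear maps $\Lambda_n:S^n\mathcal C\to\mathcal C'$ with $\Lambda_1(1)=0$ and $\Lambda_{n+1}(x_1,\dots,x_n,1)=\Lambda_n(x_1,\dots,x_n)$ for $n\ge1$. The descendant up to $\underline\Lambda$ of a morphism $f:\mathcal C_C\to\mathcal C'_C$ is the family $\underline\phi$ determined by $$fM_n(x_1,\dots,x_n)=\sum_{\pi\in P(n)}\epsilon(\pi)M'_{|\pi|}\big(\phi(x_{B_1}),\dots,\phi(x_{B_{|\pi|}})\big)+K'\Lambda_n(x_1,\dots,x_n)+\sum_{|B_i|=n-|\pi|+1}\epsilon(\pi,i)\Lambda_{|\pi|}\big(x_{B_1},\dots,\ell^K(x_{B_i}),\dots,x_{B_{|\pi|}}\big).$$ For a pointed graded vector space $\mathcal S$, a unital $sL_\infty$-morphism $\underline\varphi:(\mathcal S,\underline0)\to(\mathcal C,\underline\ell^K)$ is a family of degree $0$ linear maps $\varphi_n:S^n\mathcal S\to\mathcal C$ with $\sum_{\pi\in P(n)}\epsilon(\pi)\ell^K_{|\pi|}(\varphi(s_{B_1}),\dots,\varphi(s_{B_{|\pi|}}))=0$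 for all $n\ge1$, $\varphi_1(1_{\mathcal S})=1_{\mathcal C}$, and $\varphi_n(s_1,\dots,s_{n-1},1_{\mathcal S})=0$ for $n\ge2$; it is a quasi-isomorphism if $\varphi_1:(\mathcal S,0)\to(\mathcal C,K)$ is one. Two such morphisms are homotopic if they are the values at $\tau=0$ and $\tau=1$ of a family $\underline\Phi(\tau)$, polynomial in $\tau$, with $$\dot\Phi_n(s_1,\dots,s_n)=\sum_{\pi\in P(n)}\sum_i\epsilon(\pi,i)\,\ell^K_{|\pi|}\big(\Phi(s_{B_1}),\dots,\Phi(s_{B_{i-1}}),\eta(s_{B_i}),\Phi(s_{B_{i+1}}),\dots,\Phi(s_{B_{|\pi|}})\big),$$ where $\underline\eta(\tau)$ is polynomial in $\tau$ and consists of degree $-1$ linear maps $\eta_n:S^n\mathcal S\to\mathcal C$ with $\eta_n(s_1,\dots,s_{n-1},1_{\mathcal S})=0$; homotopy types are the classes of the equivalence relation generated by this relation. A complete space $\boldsymbol{\mathcal S}$ of homotopical random variables in $\mathcal C_C$ is a pointed graded vector space $\mathcal S$ together with the homotopy type $[\boldsymbol{\mathcal S}]$ of a unital $sL_\infty$-quasi-isomorphism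 $(\mathcal S,\underline0)\to(\mathcal C,\underline\ell^K)$. For a representative $\underline\varphi\in[\boldsymbol{\mathcal S}]$ put $$\Pi^{\underline\varphi}_n(s_1,\dots,s_n)=\sum_{\pi\in P(n)}\epsilon(\pi)M_{|\pi|}\big(\varphi(s_{B_1}),\dots,\varphi(s_{B_{|\pi|}})\big).$$ A homotopy inverse of $\varphi_1$ is a degree $0$ cochain map $h:(\mathcal C,K)\to(\mathcal S,0)$ with $h\varphi_1=I_{\mathcal S}$, together with a degree $-1$ linear map $\beta:\mathcal C\to\mathcal C$ such that $\varphi_1h=I_{\mathcal C}+K\beta+\beta K$. Theorem. Let $\boldsymbol{\mathcal S}$ be a complete space of homotopical random variables in a homotopy probability algebra $\mathcal C_C=(\mathcal C,\underline M,K)$. For every $\underline\varphi\in[\boldsymbol{\mathcal S}]$, the map $\varphi_1$ has a homotopy inverse $(h,\beta)$ with $\beta(1_{\mathcal C})=0$. There is a structure $\mathcal S_C=(\mathcal S,\underline M^{\boldsymbol{\mathcal S}},0)$ of a homotopy probability algebra with zero differential on $\mathcal S$ such that: 1. $M^{\boldsymbol{\mathcal S}}_n=h\circ\Pi^{\underline\varphi}_n$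 for all $n\ge1$, for every representative $\underline\varphi\in[\boldsymbol{\mathcal S}]$ and every homotopy inverse $(h,\beta)$ of $\varphi_1$ (so the structure is canonical); 2. for every $\underline\varphi\in[\boldsymbol{\mathcal S}]$, $\varphi_1:\mathcal S_C\to\mathcal C_C$ is a morphism of homotopy probability algebras and a quasi-isomorphism; 3. the descendant of $\mathcal S_C$ is $(\mathcal S,\underline0)$; 4. every $\underline\varphi\in[\boldsymbol{\mathcal S}]$ is the descendant of $f=\varphi_1$ up to the homotopy $\Lambda_n=\beta\circ\Pi^{\underline\varphi}_n$, for every homotopy inverse $(h,\beta)$ of $\varphi_1$ with $\beta(1_{\mathcal C})=0$; moreover, for any $\underline\varphi,\underline\psi\in[\boldsymbol{\mathcal S}]$, $\underline\psi$ is the descendant of $\varphi_1$ up to some homotopy $\underline\Lambda$. -/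

import Mathlib

open scoped DirectSum

universe u v w w'

namespace HomotopyProbability

noncomputable section

/-! ### Pointed graded vector spaces and families of multilinear operations -/

/-- A pointed `ℤ`-graded vector space `V = ⨁ⱼ Vʲ` with a distinguished element of degree `0`. -/
structure PointedGradedSpace (k : Type u) [Field k] where
  carrier : Type v
  [addCommGroup : AddCommGroup carrier]
  [module : Module k carrier]
  /-- `deg j` is the homogeneous component `Vʲ`. -/
  deg : ℤ → Submodule k carrier
  [decomposition : DirectSum.Decomposition deg]
  one : carrier
  one_mem : one ∈ deg 0

attribute [instance] PointedGradedSpace.addCommGroup PointedGradedSpace.module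
  PointedGradedSpace.decomposition

instance {k : Type u} [Field k] : CoeSort (PointedGradedSpace.{u, v} k) (Type v) :=
  ⟨PointedGradedSpace.carrier⟩

variable {k : Type u} [Field k]

/-- A family `f₁, f₂, …` of multilinear operations, `fₙ : Tⁿ V → W`. Families start at `n = 1`:
the entry of index `0` carries no information, and every axiom below is about `n ≥ 1` only. -/
abbrev Family (V : PointedGradedSpace.{u, v} k) (W : PointedGradedSpace.{u, w} k) :=
  ∀ n : ℕ, MultilinearMap k (fun _ : Fin n => V) W

/-- The linear map `f₁ : V → W` of a family. -/
def Family.linearPart {V : PointedGradedSpace.{u, v} k} {W : PointedGradedSpace.{u, w} k}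
    (f : Family V W) : V →ₗ[k] W :=
  (MultilinearMap.ofSubsingleton k V W (0 : Fin 1)).symm (f 1)

/-- The identity family `I, 0, 0, …`. -/
def idFamily (V : PointedGradedSpace.{u, v} k) : Family V V
  | 1 => MultilinearMap.ofSubsingleton k V V (0 : Fin 1) LinearMap.id
  | _ => 0

/-- The linear map `f` has degree `p`. -/
def HasDegree {V : PointedGradedSpace.{u, v} k} {W : PointedGradedSpace.{u, w} k}
    (p : ℤ) (f : V →ₗ[k] W) : Prop :=
  ∀ (j : ℤ) (x : V), x ∈ V.deg j → f x ∈ W.deg (j + p)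

/-! ### Koszul signs -/

/-- The Koszul sign of the rearrangement of homogeneous elements `x₀, …, xₙ₋₁` of degrees
`d₀, …, dₙ₋₁` into the order of increasing `pos` (elements with equal `pos` keep their order):
every pair `i < j` that is exchanged contributes `(-1) ^ (dᵢ dⱼ)`. -/
def koszulSign {n : ℕ} (d : Fin n → ℤ) {α : Type*} [LinearOrder α] (pos : Fin n → α) : ℤˣ :=
  ∏ i : Fin n, ∏ j : Fin n,
    if i < j ∧ pos j < pos i then Int.negOnePow (d i * d j) else 1

/-- The sign `ε(π)` of an ordered partition `π = B₁ ⊔ ⋯ ⊔ B_r`, that is, the Koszul sign of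
`x₁ ⊗ ⋯ ⊗ xₙ ↦ x_{B₁} ⊗ ⋯ ⊗ x_{B_r}`. An `OrderedFinpartition` has its blocks ordered by their
greatest elements, and each block is listed in increasing order. -/
def partitionSign {n : ℕ} (d : Fin n → ℤ) (π : OrderedFinpartition n) : ℤˣ :=
  koszulSign d π.index

/-- `ε(π, i) = ε(π) (-1) ^ (|x_{B₁}| + ⋯ + |x_{B_{i-1}}|)`. -/
def partitionSignAt {n : ℕ} (d : Fin n → ℤ) (π : OrderedFinpartition n) (i : Fin π.length) :
    ℤˣ :=
  partitionSign d π *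
    ∏ m : Fin π.length, if m < i then
      Int.negOnePow (∑ r : Fin (π.partSize m), d (π.emb m r)) else 1

/-- For all `n ≥ 1`, `fₙ` has degree `p` and descends to the supersymmetric power, so that it is
a linear map `Sⁿ V → W` of degree `p`. -/
structure IsSymmetricOfDegree {V : PointedGradedSpace.{u, v} k}
    {W : PointedGradedSpace.{u, w} k} (p : ℤ) (f : Family V W) : Prop where
  mem_deg : ∀ (n : ℕ), 1 ≤ n → ∀ (d : Fin n → ℤ) (x : Fin n → V), (∀ i, x i ∈ V.deg (d i)) →
    f n x ∈ W.deg (∑ i, d i + p)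
  symm : ∀ (n : ℕ), 1 ≤ n → ∀ (σ : Equiv.Perm (Fin n)) (d : Fin n → ℤ) (x : Fin n → V),
    (∀ i, x i ∈ V.deg (d i)) → f n x = koszulSign d σ.symm • f n (fun i => x (σ i))

/-! ### Sums over partitions -/

/-- The multilinear map on `Tⁿ V` that is equal to `F d` on `V^{d₁} ⊗ ⋯ ⊗ V^{dₙ}`. -/
def ofHomogeneous {V : PointedGradedSpace.{u, v} k} {W : PointedGradedSpace.{u, w} k} {n : ℕ}
    (F : (Fin n → ℤ) → MultilinearMap k (fun _ : Fin n => V) W) :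
    MultilinearMap k (fun _ : Fin n => V) W :=
  (MultilinearMap.fromDirectSumEquiv (R := k) (M := fun (_ : Fin n) (j : ℤ) => V.deg j)
    (fun d => (F d).compLinearMap (fun i => (V.deg (d i)).subtype))).compLinearMap
    (fun _ => (DirectSum.decomposeLinearEquiv V.deg).toLinearMap)

theorem ofHomogeneous_apply {V : PointedGradedSpace.{u, v} k} {W : PointedGradedSpace.{u, w} k}
    {n : ℕ} (F : (Fin n → ℤ) → MultilinearMap k (fun _ : Fin n => V) W) (d : Fin n → ℤ)
    (x : Fin n → V) (hx : ∀ i, x i ∈ V.deg (d i)) : ofHomogeneous F x = F d x := by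
  classical
  have h : (fun i => DirectSum.decomposeLinearEquiv V.deg (x i)) =
      fun i => DirectSum.lof k ℤ (fun j => V.deg j) (d i) ⟨x i, hx i⟩ := by
    funext i
    exact DirectSum.decomposeLinearEquiv_apply_coe V.deg (d i) ⟨x i, hx i⟩
  simp only [ofHomogeneous, MultilinearMap.compLinearMap_apply, LinearEquiv.coe_coe]
  rw [h]
  exact MultilinearMap.fromDirectSumEquiv_lof _ d _

theorem alongPartition_update {V : Type v} {W : Type w} [AddCommGroup V] [Module k V]
    [AddCommGroup W] [Module k W] {n : ℕ} (π : OrderedFinpartition n)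
    (p : ∀ j : Fin π.length, MultilinearMap k (fun _ : Fin (π.partSize j) => V) W)
    (x : Fin n → V) (j : Fin n) (z : V) :
    (fun m => p m (fun r => Function.update x j z (π.emb m r))) =
      Function.update (fun m => p m (fun r => x (π.emb m r))) (π.index j)
        (p (π.index j) (Function.update (fun r => x (π.emb (π.index j) r))
          (π.invEmbedding j) z)) := by
  funext m
  by_cases h : m = π.index j
  · subst h
    rw [Function.update_self]
    congr 1
    funext r
    by_cases hr : r = π.invEmbedding j
    · subst hr
      simp
    · have : π.emb (π.index j) r ≠ j := by
        intro h
        apply hr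
        apply (π.emb_strictMono (π.index j)).injective
        rw [h, π.emb_invEmbedding]
      rw [Function.update_of_ne this, Function.update_of_ne hr]
  · rw [Function.update_of_ne h]
    congr 1
    funext r
    have : π.emb m r ≠ j := by
      intro hj
      rw [← π.emb_invEmbedding j] at hj
      exact π.emb_ne_emb_of_ne h hj
    rw [Function.update_of_ne this]

/-- `x ↦ g (p₁ (x_{B₁}), …, p_r (x_{B_r}))` for a partition `π = B₁ ⊔ ⋯ ⊔ B_r`. -/
def alongPartition {V : PointedGradedSpace.{u, v} k} {W : PointedGradedSpace.{u, w} k}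
    {U : PointedGradedSpace.{u, w'} k} {n : ℕ}
    (π : OrderedFinpartition n) (g : MultilinearMap k (fun _ : Fin π.length => W) U)
    (p : ∀ j : Fin π.length, MultilinearMap k (fun _ : Fin (π.partSize j) => V) W) :
    MultilinearMap k (fun _ : Fin n => V) U :=
  MultilinearMap.mk' (fun x => g (fun j => p j (fun r => x (π.emb j r))))
    (fun x j y z => by
      simp only [alongPartition_update, MultilinearMap.map_update_add])
    (fun x j c y => by
      simp only [alongPartition_update, MultilinearMap.map_update_smul])

/-- `∑_{π ∈ P(n)} ε(π) g_{|π|} (f (x_{B₁}), …, f (x_{B_{|π|}}))`. -/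
def comp {V : PointedGradedSpace.{u, v} k} {W : PointedGradedSpace.{u, w} k}
    {U : PointedGradedSpace.{u, w'} k} (g : Family W U) (f : Family V W) : Family V U :=
  fun n => ofHomogeneous fun d =>
    ∑ π : OrderedFinpartition n,
      partitionSign d π • alongPartition π (g π.length) (fun j => f (π.partSize j))

/-- `∑_{π ∈ P(n)} ∑_i ε(π, i)
g_{|π|} (f (x_{B₁}), …, f (x_{B_{i-1}}), η (x_{B_i}), f (x_{B_{i+1}}), …, f (x_{B_{|π|}}))`.
For `f = idFamily V` only the pairs `(π, i)` in which all blocks other than `B_i` are singletons,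
that is, `|B_i| = n - |π| + 1`, contribute, and the sum is
`∑_{|B_i| = n - |π| + 1} ε(π, i) g_{|π|} (x_{B₁}, …, x_{B_{i-1}}, η (x_{B_i}), x_{B_{i+1}}, …)`. -/
def insertion {V : PointedGradedSpace.{u, v} k} {W : PointedGradedSpace.{u, w} k}
    {U : PointedGradedSpace.{u, w'} k} (g : Family W U) (f η : Family V W) : Family V U :=
  fun n => ofHomogeneous fun d =>
    ∑ π : OrderedFinpartition n, ∑ i : Fin π.length,
      partitionSignAt d π i •
        alongPartition π (g π.length)
          (Function.update (fun j => f (π.partSize j)) i (η (π.partSize i)))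

theorem comp_apply {V : PointedGradedSpace.{u, v} k} {W : PointedGradedSpace.{u, w} k}
    {U : PointedGradedSpace.{u, w'} k} (g : Family W U) (f : Family V W) (n : ℕ)
    (d : Fin n → ℤ) (x : Fin n → V) (hx : ∀ i, x i ∈ V.deg (d i)) :
    comp g f n x = ∑ π : OrderedFinpartition n,
      partitionSign d π • g π.length (fun j => f (π.partSize j) (fun r => x (π.emb j r))) := by
  rw [comp, ofHomogeneous_apply _ d x hx, sum_apply]
  rfl

theorem insertion_apply {V : PointedGradedSpace.{u, v} k} {W : PointedGradedSpace.{u, w} k}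
    {U : PointedGradedSpace.{u, w'} k} (g : Family W U) (f η : Family V W) (n : ℕ)
    (d : Fin n → ℤ) (x : Fin n → V) (hx : ∀ i, x i ∈ V.deg (d i)) :
    insertion g f η n x = ∑ π : OrderedFinpartition n, ∑ i : Fin π.length,
      partitionSignAt d π i •
        g π.length (Function.update (fun j => f (π.partSize j) (fun r => x (π.emb j r))) i
          (η (π.partSize i) (fun r => x (π.emb i r)))) := by
  rw [insertion, ofHomogeneous_apply _ d x hx, sum_apply]
  refine Finset.sum_congr rfl fun π _ => ?_
  rw [sum_apply]
  refine Finset.sum_congr rfl fun i _ => ?_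
  rw [smul_apply]
  congr 1
  change g π.length _ = g π.length _
  congr 1
  funext j
  by_cases h : j = i
  · subst h
    simp
  · simp [h]

/-! ### Homotopy probability algebras and descendants -/

/-- Appending the unit: `(x₁, …, xₙ, 1_V)`. -/
def appendOne {V : PointedGradedSpace.{u, v} k} {n : ℕ} (x : Fin n → V) : Fin (n + 1) → V :=
  Fin.snoc (α := fun _ => V) x V.one

/-- The structure of a correlation algebra on a pointed graded vector space. -/
structure CorrelationAlgebra (V : PointedGradedSpace.{u, v} k) where
  M : Family V V
  symmetric : IsSymmetricOfDegree 0 M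
  M_one : M.linearPart = LinearMap.id
  M_unit : ∀ (n : ℕ), 1 ≤ n → ∀ x : Fin n → V, M (n + 1) (appendOne x) = M n x

/-- The structure of a homotopy probability algebra on a pointed graded vector space: a
correlation algebra that is a pointed cochain complex (the unit is closed and not exact). -/
structure HomotopyProbabilityAlgebra (V : PointedGradedSpace.{u, v} k) extends
    CorrelationAlgebra V where
  K : V →ₗ[k] V
  K_degree : HasDegree 1 K
  K_comp_K : K ∘ₗ K = 0
  K_unit : K V.one = 0
  unit_not_exact : V.one ∉ LinearMap.range K

/-- A morphism of homotopy probability algebras is a pointed cochain map. -/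
structure IsMorphism {V : PointedGradedSpace.{u, v} k} {W : PointedGradedSpace.{u, w} k}
    (A : HomotopyProbabilityAlgebra V) (B : HomotopyProbabilityAlgebra W) (f : V →ₗ[k] W) :
    Prop where
  degree : HasDegree 0 f
  comm : f ∘ₗ A.K = B.K ∘ₗ f
  unit : f V.one = W.one

/-- The descendant family `ℓᴷ = ℓᴷ₁, ℓᴷ₂, …` of `(V, M, K)`, by the recursion
`ℓᴷₙ (x) = K Mₙ (x) - ∑_{|B_i| = n - |π| + 1, |π| ≠ 1} ε(π, i)
  M_{|π|} (x_{B₁}, …, x_{B_{i-1}}, ℓᴷ (x_{B_i}), x_{B_{i+1}}, …, x_{B_{|π|}})`. -/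
def HomotopyProbabilityAlgebra.descendant {V : PointedGradedSpace.{u, v} k}
    (A : HomotopyProbabilityAlgebra V) (n : ℕ) : MultilinearMap k (fun _ : Fin n => V) V :=
  A.K.compMultilinearMap (A.M n) - ofHomogeneous fun d =>
    ∑ π : OrderedFinpartition n, ∑ i : Fin π.length,
      if _h : π.partSize i < n then
        partitionSignAt d π i •
          alongPartition π (A.M π.length)
            (Function.update (fun j => idFamily V (π.partSize j)) i
              (A.descendant (π.partSize i)))
      else 0
termination_by n

/-- The partition with one block. -/
def oneBlock (n : ℕ) (hn : 0 < n) : OrderedFinpartition n where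
  length := 1
  partSize _ := n
  partSize_pos _ := hn
  emb _ := id
  emb_strictMono _ := strictMono_id
  parts_strictMono := Subsingleton.strictMono _
  disjoint := fun i _ j _ h => absurd (Subsingleton.elim i j) h
  cover x := ⟨0, x, rfl⟩

theorem eq_oneBlock {n : ℕ} (hn : 0 < n) (π : OrderedFinpartition n) (i : Fin π.length)
    (hi : n ≤ π.partSize i) : π = oneBlock n hn := by
  have hi' : π.partSize i = n := le_antisymm (π.partSize_le i) hi
  have hsurj : Function.Surjective (π.emb i) := by
    have hinj := (π.emb_strictMono i).injective
    exact ((Fintype.bijective_iff_injective_and_card _).2 ⟨hinj, by simp [hi']⟩).2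
  have hall : ∀ j, j = i := by
    intro j
    by_contra hj
    obtain ⟨r, hr⟩ := hsurj (π.emb j ⟨0, π.partSize_pos j⟩)
    exact π.emb_ne_emb_of_ne (Ne.symm hj) hr
  have hlen : π.length = 1 := by
    have : Fintype.card (Fin π.length) = 1 := Fintype.card_eq_one_iff.2 ⟨i, hall⟩
    simpa using this
  rcases π with ⟨l, s, sp, e, em, pm, dj, cv⟩
  dsimp only at *
  subst hlen
  obtain rfl : s = fun _ => n := funext fun j => by rw [hall j]; exact hi'
  have he : e = fun _ => id := by
    funext j
    exact (em j).eq_id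
  subst he
  rfl

theorem partitionSignAt_oneBlock {n : ℕ} (hn : 0 < n) (d : Fin n → ℤ)
    (i : Fin (oneBlock n hn).length) : partitionSignAt d (oneBlock n hn) i = 1 := by
  have h : ∀ a b : Fin (oneBlock n hn).length, ¬ a < b := by
    intro a b hab
    have h1 : (a : ℕ) < 1 := a.2
    have h2 : (b : ℕ) < 1 := b.2
    have h3 : (a : ℕ) < b := hab
    omega
  simp [partitionSignAt, partitionSign, koszulSign, h]

/-- The defining relations of the descendant:
`K Mₙ (x) = ∑_{|B_i| = n - |π| + 1} ε(π, i)
  M_{|π|} (x_{B₁}, …, x_{B_{i-1}}, ℓᴷ (x_{B_i}), x_{B_{i+1}}, …, x_{B_{|π|}})`. -/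
theorem HomotopyProbabilityAlgebra.descendant_relation {V : PointedGradedSpace.{u, v} k}
    (A : HomotopyProbabilityAlgebra V) (n : ℕ) (hn : 1 ≤ n) (d : Fin n → ℤ) (x : Fin n → V)
    (hx : ∀ i, x i ∈ V.deg (d i)) :
    A.K (A.M n x) = insertion A.M (idFamily V) A.descendant n x := by
  have hsplit : ∀ (π : OrderedFinpartition n) (i : Fin π.length),
      (if _h : π.partSize i < n then
        partitionSignAt d π i •
          alongPartition π (A.M π.length)
            (Function.update (fun j => idFamily V (π.partSize j)) i
              (A.descendant (π.partSize i))) else 0) x +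
        (if π.partSize i < n then 0 else A.descendant n x) =
      partitionSignAt d π i •
        A.M π.length (Function.update (fun j => idFamily V (π.partSize j)
          (fun r => x (π.emb j r))) i (A.descendant (π.partSize i) (fun r => x (π.emb i r)))) := by
    intro π i
    by_cases h : π.partSize i < n
    · rw [dif_pos h, if_pos h, add_zero, smul_apply]
      congr 1
      change A.M π.length _ = A.M π.length _
      congr 1
      funext j
      by_cases hj : j = i
      · subst hj
        simp
      · simp [hj]
    · rw [dif_neg h, if_neg h, zero_apply, zero_add]
      obtain rfl := eq_oneBlock hn π i (not_lt.1 h)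
      rw [partitionSignAt_oneBlock, one_smul]
      have hM : ∀ y : Fin 1 → V, A.M 1 y = y 0 := by
        intro y
        have := LinearMap.congr_fun A.M_one (y 0)
        rw [Family.linearPart] at this
        have hy : (fun _ : Fin 1 => y 0) = y := by
          funext a
          rw [Subsingleton.elim a 0]
        rw [← hy]
        exact this
      have hi : i = (0 : Fin 1) := Subsingleton.elim (α := Fin 1) _ _
      subst hi
      exact ((hM _).trans (Function.update_self _ _ _)).symm
  have hcount : ∑ π : OrderedFinpartition n, ∑ i : Fin π.length,
      (if π.partSize i < n then (0 : V) else A.descendant n x) = A.descendant n x := by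
    rw [Finset.sum_eq_single (oneBlock n hn)]
    · have : ∀ i : Fin (oneBlock n hn).length,
          (if (oneBlock n hn).partSize i < n then (0 : V) else A.descendant n x) =
            A.descendant n x := fun i => if_neg (lt_irrefl n)
      rw [Finset.sum_congr rfl fun i _ => this i]
      exact Fin.sum_univ_one (fun _ : Fin 1 => A.descendant n x)
    · intro π _ hπ
      refine Finset.sum_eq_zero fun i _ => if_pos ?_
      by_contra h
      exact hπ (eq_oneBlock hn π i (not_lt.1 h))
    · exact fun h => absurd (Finset.mem_univ _) h
  have hD : A.descendant n x = A.K (A.M n x) -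
      ∑ π : OrderedFinpartition n, ∑ i : Fin π.length,
        (if _h : π.partSize i < n then
          partitionSignAt d π i •
            alongPartition π (A.M π.length)
              (Function.update (fun j => idFamily V (π.partSize j)) i
                (A.descendant (π.partSize i))) else 0) x := by
    rw [HomotopyProbabilityAlgebra.descendant, sub_apply, ofHomogeneous_apply _ d x hx, sum_apply]
    simp only [sum_apply]
    rfl
  rw [insertion_apply _ _ _ n d x hx]
  simp only [← hsplit, Finset.sum_add_distrib]
  rw [hcount, hD]
  abel

/-! ### Unital `sL∞`-morphisms and their homotopy types -/

/-- A unital `sL∞`-morphism `(V, 1_V, ℓ) → (W, 1_W, ℓ')`. -/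
structure UnitalMorphism {V : PointedGradedSpace.{u, v} k} {W : PointedGradedSpace.{u, w} k}
    (ℓ : Family V V) (ℓ' : Family W W) where
  toFamily : Family V W
  symmetric : IsSymmetricOfDegree 0 toFamily
  relation : ∀ n : ℕ, 1 ≤ n → comp ℓ' toFamily n = insertion toFamily (idFamily V) ℓ n
  map_one : toFamily.linearPart V.one = W.one
  map_unit : ∀ (n : ℕ), 1 ≤ n → ∀ x : Fin n → V, toFamily (n + 1) (appendOne x) = 0

/-- A time-independent unital `sL∞`-homotopy: `λₙ : Sⁿ V → W` has degree `-1` and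
`λₙ (x₁, …, xₙ₋₁, 1_V) = 0` for `n ≥ 1`. -/
structure IsUnitalHomotopy {V : PointedGradedSpace.{u, v} k} {W : PointedGradedSpace.{u, w} k}
    (η : Family V W) : Prop where
  symmetric : IsSymmetricOfDegree (-1) η
  map_unit : ∀ (n : ℕ) (x : Fin n → V), η (n + 1) (appendOne x) = 0

/-- The function `τ ↦ c τ` is a polynomial `∑ⱼ τʲ wⱼ` with coefficients in `W`. -/
def IsPolynomial {W : Type w} [AddCommGroup W] [Module k W] (c : k → W) : Prop :=
  ∃ p : ℕ →₀ W, ∀ τ : k, c τ = p.sum fun j w => τ ^ j • w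

/-- `c` is a polynomial in `τ` and `c'` is its derivative with respect to `τ`. -/
def HasPolynomialDerivative {W : Type w} [AddCommGroup W] [Module k W] (c c' : k → W) : Prop :=
  ∃ p : ℕ →₀ W, (∀ τ : k, c τ = p.sum fun j w => τ ^ j • w) ∧
    ∀ τ : k, c' τ = p.sum fun j w => ((j : k) * τ ^ (j - 1)) • w

/-- `ψ` is obtained from `φ` by a homotopy flow: there are a polynomial family `η(τ)` of unital
`sL∞`-homotopies and a polynomial solution `Φ(τ)` of the flow equations generated by `η(τ)` with
`Φ(0) = φ` and `Φ(1) = ψ`. The term with `|π| = 1` of the first sum is `ℓ'₁ ηₙ`. -/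
def Homotopic {V : PointedGradedSpace.{u, v} k} {W : PointedGradedSpace.{u, w} k}
    {ℓ : Family V V} {ℓ' : Family W W} (φ ψ : UnitalMorphism ℓ ℓ') : Prop :=
  ∃ (η Φ : k → Family V W),
    (∀ τ, IsUnitalHomotopy (η τ)) ∧
    (∀ n : ℕ, 1 ≤ n → ∀ x : Fin n → V, IsPolynomial fun τ => η τ n x) ∧
    (∀ τ, IsSymmetricOfDegree 0 (Φ τ)) ∧
    (∀ n : ℕ, 1 ≤ n → Φ 0 n = φ.toFamily n) ∧
    (∀ n : ℕ, 1 ≤ n → Φ 1 n = ψ.toFamily n) ∧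
    ∀ n : ℕ, 1 ≤ n → ∀ x : Fin n → V,
      HasPolynomialDerivative (fun τ => Φ τ n x)
        (fun τ => insertion ℓ' (Φ τ) (η τ) n x + insertion (η τ) (idFamily V) ℓ n x)

/-- Homotopy types of unital `sL∞`-morphisms (`Quot` is the quotient by the equivalence relation
generated by `Homotopic`). -/
def HomotopyType {V : PointedGradedSpace.{u, v} k} {W : PointedGradedSpace.{u, w} k}
    (ℓ : Family V V) (ℓ' : Family W W) :=
  Quot (Homotopic : UnitalMorphism ℓ ℓ' → UnitalMorphism ℓ ℓ' → Prop)

/-! ### Quasi-isomorphisms -/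

/-- The cohomology `ker d / im d` of an endomorphism (of a differential, `d ∘ d = 0`). -/
abbrev Cohomology {V : Type v} [AddCommGroup V] [Module k V] (d : V →ₗ[k] V) :=
  LinearMap.ker d ⧸ (LinearMap.range d).submoduleOf (LinearMap.ker d)

/-- The map induced on cohomology by a cochain map. -/
def cohomologyMap {V : Type v} {W : Type w} [AddCommGroup V] [Module k V] [AddCommGroup W]
    [Module k W] {d : V →ₗ[k] V} {d' : W →ₗ[k] W} (f : V →ₗ[k] W) (hf : f ∘ₗ d = d' ∘ₗ f) :
    Cohomology d →ₗ[k] Cohomology d' :=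
  Submodule.mapQ _ _
    (f.restrict (p := LinearMap.ker d) (q := LinearMap.ker d') (fun x hx => by
      have h := LinearMap.congr_fun hf x
      simp only [LinearMap.comp_apply, LinearMap.mem_ker.1 hx, map_zero] at h
      exact LinearMap.mem_ker.2 h.symm))
    (by
      rintro ⟨x, hx⟩ ⟨y, hy⟩
      exact ⟨f y, by
        have h := LinearMap.congr_fun hf y
        simp only [LinearMap.comp_apply] at h
        rw [← h, hy]
        rfl⟩)

/-- `f` is a cochain map that induces an isomorphism on cohomology. -/
def IsQuasiIsomorphism {V : Type v} {W : Type w} [AddCommGroup V] [Module k V] [AddCommGroup W]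
    [Module k W] (d : V →ₗ[k] V) (d' : W →ₗ[k] W) (f : V →ₗ[k] W) : Prop :=
  ∃ hf : f ∘ₗ d = d' ∘ₗ f, Function.Bijective (cohomologyMap f hf)

/-! ### Complete spaces of homotopical random variables -/

/-- A complete space of homotopical random variables in the homotopy probability algebra
`(C, M, K)`: a pointed graded vector space `S`, regarded as the unital `sL∞`-algebra
`(S, 1_S, 0)`, together with the homotopy type of a unital `sL∞`-quasi-isomorphism
`(S, 1_S, 0) → (C, 1_C, ℓᴷ)`. -/
structure CompleteSpace {C : PointedGradedSpace.{u, v} k} (A : HomotopyProbabilityAlgebra C) where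
  space : PointedGradedSpace.{u, w} k
  homotopyType : HomotopyType (0 : Family space space) A.descendant
  exists_quasiIso : ∃ φ : UnitalMorphism (0 : Family space space) A.descendant,
    Quot.mk _ φ = homotopyType ∧
      IsQuasiIsomorphism (Family.linearPart (0 : Family space space))
        (Family.linearPart A.descendant) φ.toFamily.linearPart

/-- `φ` is a representative of the homotopy type of `S`. -/
def CompleteSpace.Represents {C : PointedGradedSpace.{u, v} k} {A : HomotopyProbabilityAlgebra C}
    (S : CompleteSpace.{u, v, w} A)
    (φ : UnitalMorphism (0 : Family S.space S.space) A.descendant) : Prop :=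
  (Quot.mk _ φ : HomotopyType (0 : Family S.space S.space) A.descendant) = S.homotopyType

/-- The correlation densities
`Πₙ (s₁, …, sₙ) = ∑_{π ∈ P(n)} ε(π) M_{|π|} (φ (s_{B₁}), …, φ (s_{B_{|π|}}))`. -/
def correlationDensity {S : PointedGradedSpace.{u, w} k} {C : PointedGradedSpace.{u, v} k}
    (A : HomotopyProbabilityAlgebra C) (φ : Family S C) : Family S C :=
  comp A.M φ

/-- A homotopy inverse `h` of `f : (S, 0) → (C, K)`: a cochain map with `h ∘ f = I_S`, together
with a cochain homotopy `β` such that `f ∘ h = I_C + K β + β K`. -/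
structure HomotopyInverse {S : PointedGradedSpace.{u, w} k} {C : PointedGradedSpace.{u, v} k}
    (K : C →ₗ[k] C) (f : S →ₗ[k] C) where
  h : C →ₗ[k] S
  β : C →ₗ[k] C
  h_degree : HasDegree 0 h
  β_degree : HasDegree (-1) β
  h_comp_K : h ∘ₗ K = 0
  h_comp_f : h ∘ₗ f = LinearMap.id
  f_comp_h : f ∘ₗ h = LinearMap.id + K ∘ₗ β + β ∘ₗ K

/-- The families `Λ` up to which descendants of morphisms are taken: `Λₙ : Sⁿ V → W` has degree
`-1`, `Λ₁ (1_V) = 0`, and `Λₙ₊₁ (x₁, …, xₙ, 1_V) = Λₙ (x₁, …, xₙ)` for `n ≥ 1`. -/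
structure IsDescentHomotopy {V : PointedGradedSpace.{u, v} k} {W : PointedGradedSpace.{u, w} k}
    (Λ : Family V W) : Prop where
  symmetric : IsSymmetricOfDegree (-1) Λ
  map_one : Λ.linearPart V.one = 0
  map_unit : ∀ (n : ℕ), 1 ≤ n → ∀ x : Fin n → V, Λ (n + 1) (appendOne x) = Λ n x

/-- `φ` is the descendant of the morphism `f` up to the homotopy `Λ`, that is, for all `n ≥ 1`,
`f (Mₙ (x)) = ∑_{π ∈ P(n)} ε(π) M'_{|π|} (φ (x_{B₁}), …, φ (x_{B_{|π|}})) + K' Λₙ (x)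
  + ∑_{|B_i| = n - |π| + 1} ε(π, i) Λ_{|π|} (x_{B₁}, …, ℓᴷ (x_{B_i}), …, x_{B_{|π|}})`.
This recursion determines `φ` since the term with `|π| = 1` of the first sum is `φₙ (x)`. -/
structure IsDescendantMorphism {V : PointedGradedSpace.{u, v} k}
    {W : PointedGradedSpace.{u, w} k} (A : HomotopyProbabilityAlgebra V)
    (B : HomotopyProbabilityAlgebra W) (f : V →ₗ[k] W) (Λ : Family V W) (φ : Family V W) :
    Prop where
  isMorphism : IsMorphism A B f
  isDescentHomotopy : IsDescentHomotopy Λ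
  relation : ∀ n : ℕ, 1 ≤ n →
    f.compMultilinearMap (A.M n) =
      comp B.M φ n + B.K.compMultilinearMap (Λ n) + insertion Λ (idFamily V) A.descendant n

end

end HomotopyProbability

namespace HomotopyProbability

noncomputable section

variable {k : Type u} [Field k]

/-! ### Signed sums over partitions of a list -/

section ListPartitions

/-! Everything rests on two facts about the densities `Π^φ`: they are closed, and they change only
by exact elements when `φ` is replaced by another representative.

Closedness: applying `K` to `∑ ε(π) M (φ (x_{B₁}), …)` and using the defining relation of the
descendant selects some blocks of `π`, feeds them to `ℓᴷ`, and leaves the others in `M`. Grouping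
the selected blocks into one block `B` (`partSum_select`) rewrites the sum as an insertion into `M`
of `∑ ε(σ) ℓᴷ (φ (x_{B'₁}), …)`, with `σ` a partition of `B` (`K_partSum`). For a morphism out of
`(S, 0)` these inner sums vanish (`K_correlationDensity`).

Homotopy invariance: along a flow, the derivative of the density has the velocity `∑ ± ℓᴷ (Φ, …, η,
…, Φ)` inserted into `M (Φ, …, Φ)`. By the same formula, applied to the arguments together with one
formal symbol of degree `-1` that turns a `Φ` into an `η`, this is `K` of `∑ ± M (Φ, …, η, …, Φ)`,
provided that `Φ(τ)` satisfies the morphism relations (`mark_mem_range`). Those relations at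
intermediate times are not part of the definition of a homotopy; they follow by induction on the
number of arguments. A polynomial whose derivative is exact is constant modulo exact elements in
characteristic zero, hence `Homotopic.correlationDensity_sub_mem`.

The theorem is then linear algebra. A homotopy inverse of `φ₁` exists by splitting the complex, with
`β φ₁ = 0`, so `β(1) = 0`. The map `h` kills exact elements, and on closed elements it depends on
`φ₁` only modulo exact maps, so `h ∘ Π` is canonical. Its unit axiom holds because `φ` vanishes on
blocks of size at least two ending in the unit, while `M` drops a trailing unit (`comp_appendOne`).
Finally `φ₁ h = I + K β + β K`, evaluated on the closed element `Π`, gives `φ₁ h Π = Π + K (β Π)`,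
the relation of a descendant up to `β ∘ Π`; its remaining term vanishes because a zero differential
has zero descendant.

The combinatorics is done on lists. A partition is built by putting elements in front one at a time,
each as a new first block or at the head of an existing block. This never changes a greatest element
of an old block, so blocks stay ordered by greatest elements, and identities of signed sums become
inductions on the list. -/

/-- The sign of the exchange of two symbols of degrees `a` and `b`. -/
def swapSign (a b : ℤ) : ℤˣ := (a * b).negOnePow

theorem swapSign_comm (a b : ℤ) : swapSign a b = swapSign b a := by
  rw [swapSign, swapSign, mul_comm]

theorem swapSign_add_left (a b c : ℤ) : swapSign (a + b) c = swapSign a c * swapSign b c := by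
  rw [swapSign, swapSign, swapSign, add_mul, Int.negOnePow_add]

theorem swapSign_add_right (a b c : ℤ) : swapSign a (b + c) = swapSign a b * swapSign a c := by
  rw [swapSign, swapSign, swapSign, mul_add, Int.negOnePow_add]

@[simp] theorem swapSign_zero_left (a : ℤ) : swapSign 0 a = 1 := by simp [swapSign]

@[simp] theorem swapSign_zero_right (a : ℤ) : swapSign a 0 = 1 := by simp [swapSign]

theorem swapSign_mul_self (a b : ℤ) : swapSign a b * swapSign a b = 1 :=
  Int.units_mul_self _

theorem swapSign_mul_self_mul (a b : ℤ) (c : ℤˣ) : swapSign a b * (swapSign a b * c) = c := by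
  rw [← mul_assoc, swapSign_mul_self, one_mul]

variable {X Y : Type*} {U U' : Type*} [AddCommGroup U] [AddCommGroup U']

/-- The total degree of a list of symbols. -/
def listDeg (deg : X → ℤ) (B : List X) : ℤ := (B.map deg).sum

@[simp] theorem listDeg_nil (deg : X → ℤ) : listDeg deg [] = 0 := rfl

@[simp] theorem listDeg_cons (deg : X → ℤ) (x : X) (B : List X) :
    listDeg deg (x :: B) = deg x + listDeg deg B := by simp [listDeg]

@[simp] theorem listDeg_append (deg : X → ℤ) (A B : List X) :
    listDeg deg (A ++ B) = listDeg deg A + listDeg deg B := by simp [listDeg]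

/-- The signed sum of `g pre B post` over all decompositions `π = pre ++ B :: post`, where an
operator of degree `p` is moved in front of `B`. -/
def mark (deg : Y → ℤ) (p : ℤ) : List Y → (List Y → Y → List Y → U) → U
  | [], _ => 0
  | B :: π, g => g [] B π + swapSign p (deg B) • mark deg p π (fun pre => g (B :: pre))

/-- The signed sum over all ways to put `x` in front of one of the blocks. -/
def join (deg : X → ℤ) (x : X) : List (List X) → (List (List X) → U) → U
  | [], _ => 0
  | B :: π, G => G ((x :: B) :: π) +
      swapSign (deg x) (listDeg deg B) • join deg x π (fun ρ => G (B :: ρ))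

/-- The signed sum over all ways to add `x` to a partition, as a new block or to a block. -/
def adjoin (deg : X → ℤ) (x : X) (π : List (List X)) (G : List (List X) → U) : U :=
  G ([x] :: π) + join deg x π G

/-- The signed sum of `G` over all ways to add the elements of `xs`, one after the other and
starting from the last one, to a given partition `π`. For `π = []` this is the signed sum over
the partitions of `xs`. -/
def partSum (deg : X → ℤ) : List X → List (List X) → (List (List X) → U) → U
  | [], π, G => G π
  | x :: xs, π, G => partSum deg xs π (fun ρ => adjoin deg x ρ G)

/-- The signed sum over all ways to select a nonempty sublist `σ` of `π`, to be placed at the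
position of its last element, between the unselected elements `pre` and `post`, where an operator
of degree `1` is moved in front of `σ`. -/
def select (deg : Y → ℤ) : List Y → (List Y → List Y → List Y → U) → U
  | [], _ => 0
  | b :: π, G => G [] [b] π + select deg π (fun pre σ post =>
      swapSign (deg b) 1 • G (b :: pre) σ post +
        swapSign (deg b) (listDeg deg pre) • G pre (b :: σ) post)

/-! #### Linearity -/

theorem mark_add (deg : Y → ℤ) (p : ℤ) (π : List Y) (g g' : List Y → Y → List Y → U) :
    mark deg p π (fun pre B post => g pre B post + g' pre B post) =
      mark deg p π g + mark deg p π g' := by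
  induction π generalizing g g' with
  | nil => simp [mark]
  | cons B π ih => simp only [mark, ih, smul_add]; abel

theorem mark_smul (deg : Y → ℤ) (p : ℤ) (c : ℤˣ) (π : List Y) (g : List Y → Y → List Y → U) :
    mark deg p π (fun pre B post => c • g pre B post) = c • mark deg p π g := by
  induction π generalizing g with
  | nil => simp [mark]
  | cons B π ih => simp only [mark, ih, smul_add, smul_smul, mul_comm]

theorem mark_congr (deg : Y → ℤ) (p : ℤ) (π : List Y) {g g' : List Y → Y → List Y → U}
    (h : ∀ pre B post, pre ++ B :: post = π → g pre B post = g' pre B post) :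
    mark deg p π g = mark deg p π g' := by
  induction π generalizing g g' with
  | nil => rfl
  | cons B π ih =>
    rw [mark, mark, h [] B π rfl, ih (fun pre B' post e => h (B :: pre) B' post (by simp [e]))]

theorem join_map (deg : X → ℤ) (x : X) (F : U →+ U') (π : List (List X))
    (G : List (List X) → U) : F (join deg x π G) = join deg x π (fun ρ => F (G ρ)) := by
  induction π generalizing G with
  | nil => simp [join]
  | cons B π ih => simp [join, ih, Units.smul_def]

theorem join_add (deg : X → ℤ) (x : X) (π : List (List X)) (G G' : List (List X) → U) :
    join deg x π (fun ρ => G ρ + G' ρ) = join deg x π G + join deg x π G' := by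
  induction π generalizing G G' with
  | nil => simp [join]
  | cons B π ih => simp only [join, ih, smul_add]; abel

theorem join_smul (deg : X → ℤ) (x : X) (c : ℤˣ) (π : List (List X)) (G : List (List X) → U) :
    join deg x π (fun ρ => c • G ρ) = c • join deg x π G := by
  induction π generalizing G with
  | nil => simp [join]
  | cons B π ih => simp only [join, ih, smul_add, smul_smul, mul_comm]

/-- A sign depending on the total degree is changed by the degree of the added element. -/
theorem join_deg_smul (deg : X → ℤ) (x : X) (s : ℤ → ℤˣ) (π : List (List X))
    (G : List (List X) → U) :
    join deg x π (fun ρ => s (listDeg (listDeg deg) ρ) • G ρ) =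
      s (deg x + listDeg (listDeg deg) π) • join deg x π G := by
  induction π generalizing G s with
  | nil => simp [join]
  | cons B π ih =>
    simp only [join, listDeg_cons]
    rw [ih (fun d => s (listDeg deg B + d))]
    simp only [smul_add, smul_smul, add_assoc, mul_comm, add_left_comm]

theorem join_append (deg : X → ℤ) (x : X) (π ρ : List (List X)) (G : List (List X) → U) :
    join deg x (π ++ ρ) G = join deg x π (fun α => G (α ++ ρ)) +
      swapSign (deg x) (listDeg (listDeg deg) π) • join deg x ρ (fun β => G (π ++ β)) := by
  induction π generalizing G with
  | nil => simp [join]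
  | cons B π ih =>
    simp only [join, ih, List.cons_append, listDeg_cons, swapSign_add_right, smul_add, smul_smul,
      add_assoc]

theorem adjoin_add (deg : X → ℤ) (x : X) (π : List (List X)) (G G' : List (List X) → U) :
    adjoin deg x π (fun ρ => G ρ + G' ρ) = adjoin deg x π G + adjoin deg x π G' := by
  simp only [adjoin, join_add]; abel

theorem adjoin_smul (deg : X → ℤ) (x : X) (c : ℤˣ) (π : List (List X))
    (G : List (List X) → U) : adjoin deg x π (fun ρ => c • G ρ) = c • adjoin deg x π G := by
  simp only [adjoin, join_smul, smul_add]

theorem adjoin_map (deg : X → ℤ) (x : X) (F : U →+ U') (π : List (List X))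
    (G : List (List X) → U) : F (adjoin deg x π G) = adjoin deg x π (fun ρ => F (G ρ)) := by
  simp only [adjoin, join_map, map_add]

theorem partSum_add (deg : X → ℤ) (xs : List X) (π : List (List X))
    (G G' : List (List X) → U) :
    partSum deg xs π (fun ρ => G ρ + G' ρ) = partSum deg xs π G + partSum deg xs π G' := by
  induction xs generalizing G G' with
  | nil => rfl
  | cons x xs ih => simp only [partSum, adjoin_add, ih]

theorem partSum_smul (deg : X → ℤ) (c : ℤˣ) (xs : List X) (π : List (List X))
    (G : List (List X) → U) :
    partSum deg xs π (fun ρ => c • G ρ) = c • partSum deg xs π G := by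
  induction xs generalizing G with
  | nil => rfl
  | cons x xs ih => simp only [partSum, adjoin_smul, ih]

theorem partSum_map (deg : X → ℤ) (F : U →+ U') (xs : List X) (π : List (List X))
    (G : List (List X) → U) :
    F (partSum deg xs π G) = partSum deg xs π (fun ρ => F (G ρ)) := by
  induction xs generalizing G with
  | nil => rfl
  | cons x xs ih => simp only [partSum, adjoin_map, ih]

theorem partSum_append (deg : X → ℤ) (xs ys : List X) (π : List (List X))
    (G : List (List X) → U) :
    partSum deg (xs ++ ys) π G = partSum deg ys π (fun ρ => partSum deg xs ρ G) := by
  induction xs generalizing G with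
  | nil => rfl
  | cons x xs ih => simp only [partSum, List.cons_append, ih]

theorem select_add (deg : Y → ℤ) (π : List Y) (G G' : List Y → List Y → List Y → U) :
    select deg π (fun pre σ post => G pre σ post + G' pre σ post) =
      select deg π G + select deg π G' := by
  induction π generalizing G G' with
  | nil => simp [select]
  | cons b π ih => simp only [select, smul_add, ih]; abel

theorem select_smul (deg : Y → ℤ) (c : ℤˣ) (π : List Y) (G : List Y → List Y → List Y → U) :
    select deg π (fun pre σ post => c • G pre σ post) = c • select deg π G := by
  induction π generalizing G with
  | nil => simp [select]
  | cons b π ih =>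
    simp only [select, smul_add, ← ih, smul_smul, mul_comm]

/-! #### Adding an element to the source of `mark` and `select` -/

/-- The three terms are the places where `x` can land: before the marked block, so that the operator
of degree `p` has to pass `x`; inside the marked block, after passing `pre`; or behind it, after
passing `pre` and `B`. -/
theorem join_mark (deg : X → ℤ) (x : X) (p : ℤ) (ρ : List (List X))
    (g : List (List X) → List X → List (List X) → U) :
    join deg x ρ (fun α => mark (listDeg deg) p α g) =
      mark (listDeg deg) p ρ (fun pre B post =>
        swapSign (deg x) p • join deg x pre (fun α => g α B post) +
        swapSign (deg x) (listDeg (listDeg deg) pre) • g pre (x :: B) post +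
        swapSign (deg x) (listDeg (listDeg deg) pre + listDeg deg B) •
          join deg x post (fun β => g pre B β)) := by
  induction ρ generalizing g with
  | nil => simp [join, mark]
  | cons B ρ ih =>
    simp only [join, mark, join_add, join_smul, ih, listDeg_cons, swapSign_add_right,
      listDeg_nil, swapSign_zero_right, one_smul, smul_zero, zero_add, smul_add, mark_add,
      swapSign_comm p (deg x)]
    simp only [← mark_smul, smul_smul, mul_comm, mul_left_comm, mul_assoc]
    abel

/-- The same trichotomy as in `join_mark`, with the selected sublist in the role of the marked
block. The selected blocks were moved over unselected ones, which is why `join_deg_smul` and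
cancelling pairs of signs enter. -/
theorem join_select (deg : X → ℤ) (x : X) (π : List (List X))
    (G : List (List X) → List (List X) → List (List X) → U) :
    join deg x π (fun α => select (listDeg deg) α G) =
      select (listDeg deg) π (fun pre σ post =>
        swapSign (deg x) 1 • join deg x pre (fun α => G α σ post) +
        swapSign (deg x) (listDeg (listDeg deg) pre) • join deg x σ (fun α => G pre α post) +
        swapSign (deg x) (listDeg (listDeg deg) pre + listDeg (listDeg deg) σ) •
          join deg x post (fun β => G pre σ β)) := by
  induction π generalizing G with
  | nil => simp [join, select]
  | cons B π ih =>
    simp only [join, select, join_add, join_smul, ih, listDeg_cons, swapSign_add_right,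
      swapSign_add_left,
      listDeg_nil, swapSign_zero_right, one_smul, smul_zero, zero_add, add_zero, smul_add,
      select_add, join_deg_smul _ _ (swapSign (listDeg deg B))]
    simp only [← select_smul, smul_smul, mul_comm, mul_left_comm, mul_assoc,
      swapSign_comm (listDeg deg B) (deg x), swapSign_mul_self_mul]
    abel

end ListPartitions

/-! ### Comparison of partitions of lists with `OrderedFinpartition`. -/

section ListPartitions

variable {X Y : Type*} {U U' : Type*} [AddCommGroup U] [AddCommGroup U']

theorem join_ofFn (deg : X → ℤ) (x : X) {r : ℕ} (B : Fin r → List X) (G : List (List X) → U) :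
    join deg x (List.ofFn B) G = ∑ i : Fin r,
      (∏ m : Fin r, if m < i then swapSign (deg x) (listDeg deg (B m)) else 1) •
        G (List.ofFn (Function.update B i (x :: B i))) := by
  induction r generalizing G with
  | zero => simp [join]
  | succ r ih =>
    rw [List.ofFn_succ, join, Fin.sum_univ_succ, ih, Finset.smul_sum]
    congr 1
    · simp [List.ofFn_succ]
    · refine Finset.sum_congr rfl fun i _ => ?_
      rw [smul_smul, Fin.prod_univ_succ]
      have h0 : Function.update B i.succ (x :: B i.succ) 0 = B 0 := by
        rw [Function.update_of_ne (Fin.succ_ne_zero i).symm]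
      have hs : (fun j : Fin r => Function.update B i.succ (x :: B i.succ) j.succ) =
          Function.update (fun j => B j.succ) i (x :: B i.succ) := by
        funext j
        by_cases h : j = i
        · subst h; simp
        · rw [Function.update_of_ne h, Function.update_of_ne (by simpa using h)]
      simp only [List.ofFn_succ, h0, hs]
      simp

theorem mark_ofFn (deg : Y → ℤ) (p : ℤ) {r : ℕ} (B : Fin r → Y)
    (g : List Y → Y → List Y → U) :
    mark deg p (List.ofFn B) g = ∑ i : Fin r,
      (∏ m : Fin r, if m < i then swapSign p (deg (B m)) else 1) •
        g ((List.ofFn B).take i) (B i) ((List.ofFn B).drop (i + 1)) := by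
  induction r generalizing g with
  | zero => simp [mark]
  | succ r ih =>
    rw [List.ofFn_succ, mark, Fin.sum_univ_succ, ih, Finset.smul_sum]
    congr 1
    · simp
    · refine Finset.sum_congr rfl fun i _ => ?_
      rw [smul_smul, Fin.prod_univ_succ]
      simp

/-- The list of the blocks of `π`, with the symbols `x i` instead of the indices `i`. -/
def blocks {n : ℕ} (π : OrderedFinpartition n) (x : Fin n → X) : List (List X) :=
  List.ofFn fun m => List.ofFn fun r => x (π.emb m r)

theorem index_eq {n : ℕ} (π : OrderedFinpartition n) {j : Fin n} {m : Fin π.length}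
    {r : Fin (π.partSize m)} (h : π.emb m r = j) : π.index j = m := by
  by_contra hne
  exact π.emb_ne_emb_of_ne hne ((π.emb_invEmbedding j).trans h.symm)

theorem blocks_extendLeft {n : ℕ} (c : OrderedFinpartition n) (x : Fin (n + 1) → X) :
    blocks c.extendLeft x = [x 0] :: blocks c (fun j => x j.succ) := by
  exact List.ofFn_succ (n := c.length) (f := fun m : Fin (c.length + 1) =>
    List.ofFn fun r => x (c.extendLeft.emb m r))

theorem index_extendLeft_zero {n : ℕ} (c : OrderedFinpartition n) :
    c.extendLeft.index 0 = (0 : Fin (c.length + 1)) :=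
  index_eq c.extendLeft (m := (0 : Fin (c.length + 1))) (r := (0 : Fin 1)) rfl

theorem index_extendLeft_succ {n : ℕ} (c : OrderedFinpartition n) (j : Fin n) :
    c.extendLeft.index j.succ = (c.index j).succ :=
  index_eq c.extendLeft (m := (c.index j).succ) (r := c.invEmbedding j)
    (congrArg Fin.succ (c.emb_invEmbedding j))

theorem partitionSign_extendLeft {n : ℕ} (c : OrderedFinpartition n) (d : Fin (n + 1) → ℤ) :
    partitionSign d c.extendLeft = partitionSign (fun j => d j.succ) c := by
  have h0 : ∀ j : Fin n, ¬ c.extendLeft.index j.succ < c.extendLeft.index 0 := by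
    intro j
    rw [index_extendLeft_succ, index_extendLeft_zero]
    exact Fin.not_lt_zero _
  have h1 : ∀ i j : Fin n, c.extendLeft.index i.succ < c.extendLeft.index j.succ ↔
      c.index i < c.index j := by
    intro i j
    rw [index_extendLeft_succ, index_extendLeft_succ]
    exact Fin.succ_lt_succ_iff
  simp [partitionSign, koszulSign, Fin.prod_univ_succ, h0, h1]

theorem ofFn_emb_extendMiddle {n : ℕ} (c : OrderedFinpartition n) (i m : Fin c.length)
    (x : Fin (n + 1) → X) :
    (List.ofFn fun r => x ((c.extendMiddle i).emb m r)) =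
      if m = i then x 0 :: List.ofFn fun r => x (c.emb m r).succ
      else List.ofFn fun r => x (c.emb m r).succ := by
  by_cases h : m = i
  · subst h
    rw [if_pos rfl]
    have e : (c.extendMiddle m).partSize m = c.partSize m + 1 := by simp
    rw [List.ofFn_congr e, List.ofFn_succ]
    simp only [OrderedFinpartition.extendMiddle, dite_true]
    rfl
  · rw [if_neg h]
    have e : (c.extendMiddle i).partSize m = c.partSize m := by simp [h]
    rw [List.ofFn_congr e]
    simp only [OrderedFinpartition.extendMiddle, h, dite_false]
    rfl

theorem blocks_extendMiddle {n : ℕ} (c : OrderedFinpartition n) (i : Fin c.length)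
    (x : Fin (n + 1) → X) :
    blocks (c.extendMiddle i) x = List.ofFn (Function.update
      (fun m => List.ofFn fun r => x (c.emb m r).succ) i
      (x 0 :: List.ofFn fun r => x (c.emb i r).succ)) := by
  change List.ofFn (n := c.length) (fun m : Fin c.length =>
    List.ofFn fun r => x ((c.extendMiddle i).emb m r)) = _
  congr 1
  funext m
  rw [ofFn_emb_extendMiddle]
  by_cases h : m = i
  · subst h; simp
  · simp [h]

theorem index_extendMiddle_succ {n : ℕ} (c : OrderedFinpartition n) (i : Fin c.length)
    (j : Fin n) : (c.extendMiddle i).index j.succ = c.index j := by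
  have h : j.succ ∈ List.ofFn fun r => (c.extendMiddle i).emb (c.index j) r := by
    have := ofFn_emb_extendMiddle c i (c.index j) id
    simp only [id] at this
    rw [this]
    have : j.succ ∈ List.ofFn fun r => (c.emb (c.index j) r).succ :=
      List.mem_ofFn.2 ⟨c.invEmbedding j, by simp⟩
    split_ifs
    · exact List.mem_cons_of_mem _ this
    · exact this
  obtain ⟨r, hr⟩ := List.mem_ofFn.1 h
  exact index_eq (c.extendMiddle i) hr

/-- Regroups a product over elements as a product over blocks. It turns the pairwise Koszul signs of
a new smallest element into one sign per block that it passes. -/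
theorem prod_index_lt {n : ℕ} (c : OrderedFinpartition n) (i : Fin c.length) (s : Fin n → ℤˣ) :
    ∏ j, (if c.index j < i then s j else 1) =
      ∏ m, if m < i then ∏ r, s (c.emb m r) else 1 := by
  rw [← c.prod_sigma_eq_prod]
  refine Finset.prod_congr rfl fun m _ => ?_
  simp only [index_eq c rfl]
  split_ifs <;> simp

theorem swapSign_sum_right {r : ℕ} (a : ℤ) (d : Fin r → ℤ) :
    swapSign a (∑ i, d i) = ∏ i, swapSign a (d i) := by
  induction r with
  | zero => simp
  | succ r ih => rw [Fin.sum_univ_succ, Fin.prod_univ_succ, swapSign_add_right, ih]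

/-- The new element `0` precedes all others, so the new exchanged pairs are exactly those of `0`
with the elements of the blocks before `i`, its own block; the other pairs are those of `c`. -/
theorem partitionSign_extendMiddle {n : ℕ} (c : OrderedFinpartition n) (i : Fin c.length)
    (d : Fin (n + 1) → ℤ) :
    partitionSign d (c.extendMiddle i) =
      (∏ m, if m < i then swapSign (d 0) (∑ r, d (c.emb m r).succ) else 1) *
        partitionSign (fun j => d j.succ) c := by
  have h0 := c.index_extendMiddle_zero i
  have h1 := index_extendMiddle_succ c i
  have h2 := prod_index_lt c i (fun j => swapSign (d 0) (d j.succ))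
  simp only [partitionSign, koszulSign, Fin.prod_univ_succ, swapSign_sum_right, h0, h1] at h2 ⊢
  rw [← h2]
  simp [swapSign]
  rfl

theorem listDeg_ofFn (deg : X → ℤ) {r : ℕ} (x : Fin r → X) :
    listDeg deg (List.ofFn x) = ∑ i, deg (x i) := by
  simp [listDeg, List.map_ofFn, List.sum_ofFn]

/-- The sum over the partitions of a list is the sum over all `OrderedFinpartition`s. -/
theorem partSum_ofFn (deg : X → ℤ) {n : ℕ} (x : Fin n → X) (G : List (List X) → U) :
    partSum deg (List.ofFn x) [] G =
      ∑ π : OrderedFinpartition n, partitionSign (fun i => deg (x i)) π • G (blocks π x) := by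
  induction n generalizing G with
  | zero =>
    rw [Fintype.sum_unique]
    have : (default : OrderedFinpartition 0).length = 0 :=
      Nat.le_zero.1 (default : OrderedFinpartition 0).length_le
    have hb : blocks (default : OrderedFinpartition 0) x = [] := by
      simp [blocks]
    rw [hb]
    simp [partSum, partitionSign, koszulSign]
  | succ n ih =>
    -- A partition of `n + 1` elements is a partition `c` of the last `n` together with an option:
    -- `none` makes `0` a new first block, `some i` puts it into the block `i`. These are the two
    -- summands of `adjoin`.
    rw [List.ofFn_succ, partSum, ih, ← (OrderedFinpartition.extendEquiv n).sum_comp,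
      Fintype.sum_sigma]
    refine Finset.sum_congr rfl fun c _ => ?_
    rw [Fintype.sum_option, adjoin, smul_add]
    congr 1
    · change _ = partitionSign _ c.extendLeft • G (blocks c.extendLeft x)
      rw [partitionSign_extendLeft, blocks_extendLeft]
    · rw [blocks, join_ofFn, Finset.smul_sum]
      refine Finset.sum_congr rfl fun i _ => ?_
      change _ = partitionSign _ (c.extendMiddle i) • G (blocks (c.extendMiddle i) x)
      rw [partitionSign_extendMiddle, blocks_extendMiddle, smul_smul, mul_comm]
      simp only [listDeg_ofFn]

theorem partSum_eq_sum (deg : X → ℤ) (xs : List X) (G : List (List X) → U) :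
    partSum deg xs [] G = ∑ π : OrderedFinpartition xs.length,
      partitionSign (fun i => deg (xs.get i)) π • G (blocks π xs.get) := by
  rw [← partSum_ofFn, List.ofFn_get]

theorem ne_nil_of_mem_blocks {n : ℕ} {π : OrderedFinpartition n} {x : Fin n → X} {B : List X}
    (h : B ∈ blocks π x) : B ≠ [] := by
  obtain ⟨m, rfl⟩ := List.mem_ofFn.1 h
  intro h0
  have := congrArg List.length h0
  rw [List.length_ofFn] at this
  exact (π.partSize_pos m).ne' this

theorem listDeg_blocks {n : ℕ} (π : OrderedFinpartition n) (x : Fin n → X) (deg : X → ℤ) :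
    listDeg (listDeg deg) (blocks π x) = ∑ i, deg (x i) := by
  rw [blocks, listDeg_ofFn, ← π.sum_sigma_eq_sum]
  simp only [listDeg_ofFn]

theorem sum_get (deg : X → ℤ) (xs : List X) : ∑ i, deg (xs.get i) = listDeg deg xs := by
  rw [← listDeg_ofFn, List.ofFn_get]

/-- Quantifying over all degree functions `deg'` makes one hypothesis serve two purposes: `deg' =
deg` compares Koszul signs, and the constant function `1` counts symbols. -/
theorem partSum_congr (deg : X → ℤ) (xs : List X) {G G' : List (List X) → U}
    (h : ∀ ρ : List (List X), (∀ B ∈ ρ, B ≠ []) →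
      (∀ deg' : X → ℤ, listDeg (listDeg deg') ρ = listDeg deg' xs) → G ρ = G' ρ) :
    partSum deg xs [] G = partSum deg xs [] G' := by
  rw [partSum_eq_sum, partSum_eq_sum]
  refine Finset.sum_congr rfl fun π _ => ?_
  rw [h _ (fun B => ne_nil_of_mem_blocks) fun deg' => by rw [listDeg_blocks, sum_get]]

theorem partSum_mem {k : Type*} [Field k] [Module k U] (N : Submodule k U) (deg : X → ℤ)
    (xs : List X) {G : List (List X) → U}
    (h : ∀ ρ : List (List X), (∀ B ∈ ρ, B ≠ []) →
      (∀ deg' : X → ℤ, listDeg (listDeg deg') ρ = listDeg deg' xs) → G ρ ∈ N) :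
    partSum deg xs [] G ∈ N := by
  rw [partSum_eq_sum]
  refine N.sum_mem fun π _ => ?_
  rw [Units.smul_def]
  exact N.toAddSubgroup.zsmul_mem
    (h _ (fun B => ne_nil_of_mem_blocks) fun deg' => by rw [listDeg_blocks, sum_get]) _

/-! ### Selecting blocks versus marking a block. -/

/-- The terms obtained by adding `x` to the selected or to the unselected blocks. -/
def adjoinSelected (deg : X → ℤ) (x : X) (G : List (List X) → List (List X) → List (List X) → U)
    (pre σ post : List (List X)) : U :=
  swapSign (deg x) 1 • adjoin deg x pre (fun α => G α σ post) +
    swapSign (deg x) (listDeg (listDeg deg) pre) • adjoin deg x σ (fun α => G pre α post) +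
    swapSign (deg x) (listDeg (listDeg deg) pre + listDeg (listDeg deg) σ) •
      join deg x post (fun β => G pre σ β)

/-- The new block `[x]` is selected alone (first term), left unselected, or selected together with
later blocks. The last two cases complete `join` to `adjoin` on `pre` and on `σ`; nothing new can
appear in `post`, which lies behind. -/
theorem adjoin_select (deg : X → ℤ) (x : X) (π : List (List X))
    (G : List (List X) → List (List X) → List (List X) → U) :
    adjoin deg x π (fun α => select (listDeg deg) α G) =
      G [] [[x]] π + select (listDeg deg) π (adjoinSelected deg x G) := by
  rw [adjoin, select, join_select, add_assoc, ← select_add]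
  congr 2
  funext pre σ post
  simp only [adjoinSelected, adjoin, smul_add, listDeg_cons, listDeg_nil, add_zero]
  abel

theorem adjoin_mark (deg : X → ℤ) (x : X) (p : ℤ) (ρ : List (List X))
    (g : List (List X) → List X → List (List X) → U) :
    adjoin deg x ρ (fun α => mark (listDeg deg) p α g) =
      g [] [x] ρ + mark (listDeg deg) p ρ (fun pre B post =>
        swapSign (deg x) p • adjoin deg x pre (fun α => g α B post) +
        swapSign (deg x) (listDeg (listDeg deg) pre) • g pre (x :: B) post +
        swapSign (deg x) (listDeg (listDeg deg) pre + listDeg deg B) •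
          join deg x post (fun β => g pre B β)) := by
  rw [adjoin, mark, join_mark, add_assoc, ← mark_smul, ← mark_add]
  congr 2
  funext pre B post
  simp only [adjoin, smul_add, listDeg_cons, listDeg_nil, add_zero, swapSign_comm p]
  abel

theorem join_partSum (deg : X → ℤ) (x : X) (B : List X) (ρ π : List (List X))
    (H : List (List X) → List (List X) → U) :
    join deg x π (fun α => partSum deg B ρ (H α)) =
      partSum deg B ρ (fun σ => join deg x π (fun α => H α σ)) := by
  induction π generalizing H with
  | nil => simpa [join] using (partSum_map deg (0 : U →+ U) B ρ fun _ => 0)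
  | cons A π ih => simp only [join, ih, partSum_add, partSum_smul]

/-- Selecting a set of blocks of a partition amounts to partitioning a marked block. -/
theorem partSum_select (deg : X → ℤ) (xs : List X)
    (G : List (List X) → List (List X) → List (List X) → U) :
    partSum deg xs [] (fun π => select (listDeg deg) π G) =
      partSum deg xs [] (fun ρ => mark (listDeg deg) 1 ρ fun pre B post =>
        partSum deg B [] fun σ => G pre σ post) := by
  induction xs generalizing G with
  | nil => simp [partSum, select, mark]
  | cons x xs ih =>
    -- On both sides `x` either forms the selected (marked) part alone or enters one of three zones.
    -- Entering the marked block `B` before it is partitioned amounts to adjoining `x` to the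
    -- partition `σ` of `B`.
    simp only [partSum, adjoin_select, adjoin_mark, partSum_add, ih]
    congr 1
    · simp [adjoin, join]
    refine partSum_congr deg xs fun ρ _ _ => mark_congr _ _ _ fun pre B post _ => ?_
    simp only [adjoinSelected, partSum_add, partSum_smul]
    congr 1
    · simp only [adjoin, join_partSum, partSum_add]
    · rw [join_partSum, ← partSum_smul]
      refine partSum_congr deg B fun σ _ hσ => ?_
      -- `σ` is a partition of `B`, so passing the selected blocks costs `x` the same sign as
      -- passing `B`.
      rw [hσ deg]

end ListPartitions

/-! ### Sums in which all unmarked blocks are singletons. -/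

section ListPartitions

variable {X Y : Type*} {U U' : Type*} [AddCommGroup U] [AddCommGroup U']

theorem join_eq_zero_of_long (deg : X → ℤ) (x : X) (π : List (List X)) (H : List (List X) → U)
    (hH : ∀ ρ, (∃ B ∈ ρ, 2 ≤ B.length) → H ρ = 0) (hπ : ∃ B ∈ π, 2 ≤ B.length) :
    join deg x π H = 0 := by
  induction π generalizing H with
  | nil => rfl
  | cons B π ih =>
    obtain ⟨A, hA, hA2⟩ := hπ
    have h2 : join deg x π (fun ρ => H (B :: ρ)) = 0 := by
      rcases List.mem_cons.1 hA with rfl | hA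
      · have : (fun ρ => H (A :: ρ)) = fun ρ => (0 : U →+ U) 0 := by
          funext ρ
          exact hH _ ⟨A, by simp, hA2⟩
        rw [this, ← join_map]
        rfl
      · exact ih _ (fun ρ ⟨D, hD, hD2⟩ => hH _ ⟨D, by simp [hD], hD2⟩) ⟨A, hA, hA2⟩
    rw [join, h2, smul_zero, add_zero]
    rcases List.mem_cons.1 hA with rfl | hA
    · exact hH _ ⟨x :: A, by simp, by simp; omega⟩
    · exact hH _ ⟨A, by simp [hA], hA2⟩

theorem join_singletons (deg : X → ℤ) (x : X) (xs : List X) (H : List (List X) → U)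
    (hH : ∀ ρ, (∃ B ∈ ρ, 2 ≤ B.length) → H ρ = 0) :
    join deg x (xs.map fun y => [y]) H = 0 := by
  induction xs generalizing H with
  | nil => rfl
  | cons y xs ih =>
    rw [List.map_cons, join, hH _ ⟨[x, y], by simp, by simp⟩,
      ih _ (fun ρ ⟨D, hD, hD2⟩ => hH _ ⟨D, by simp [hD], hD2⟩), smul_zero, add_zero]

theorem adjoin_eq_zero_of_long (deg : X → ℤ) (x : X) (π : List (List X))
    (H : List (List X) → U) (hH : ∀ ρ, (∃ B ∈ ρ, 2 ≤ B.length) → H ρ = 0)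
    (hπ : ∃ B ∈ π, 2 ≤ B.length) : adjoin deg x π H = 0 := by
  obtain ⟨B, hB, hB2⟩ := hπ
  rw [adjoin, hH _ ⟨B, by simp [hB], hB2⟩, join_eq_zero_of_long _ _ _ _ hH ⟨B, hB, hB2⟩, add_zero]

/-- If only partitions into singletons contribute, the sum has one term. -/
theorem partSum_singletons (deg : X → ℤ) (xs : List X) (H : List (List X) → U)
    (hH : ∀ ρ, (∃ B ∈ ρ, 2 ≤ B.length) → H ρ = 0) :
    partSum deg xs [] H = H (xs.map fun y => [y]) := by
  induction xs generalizing H with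
  | nil => rfl
  | cons x xs ih =>
    rw [partSum, ih _ (fun ρ => adjoin_eq_zero_of_long deg x ρ H hH), adjoin,
      join_singletons _ _ _ _ hH, add_zero, List.map_cons]

theorem listDeg_singletons (deg : X → ℤ) (xs : List X) :
    listDeg (listDeg deg) (xs.map fun y => [y]) = listDeg deg xs := by
  induction xs with
  | nil => rfl
  | cons x xs ih => simp [ih]

/-- When every block outside the marked one is a singleton, the marked partition is determined by
the sublist forming the marked block, placed at its last element. This is the list form of the
condition `|B_i| = n - |π| + 1`. -/
theorem partSum_mark_singletons (deg : X → ℤ) (xs : List X)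
    (g : List (List X) → List X → List (List X) → U)
    (hpre : ∀ pre B post, (∃ A ∈ pre, 2 ≤ A.length) → g pre B post = 0)
    (hpost : ∀ pre B post, (∃ A ∈ post, 2 ≤ A.length) → g pre B post = 0) :
    partSum deg xs [] (fun ρ => mark (listDeg deg) 1 ρ g) =
      select deg xs fun pre σ post => g (pre.map fun y => [y]) σ (post.map fun y => [y]) := by
  induction xs generalizing g with
  | nil => rfl
  | cons x xs ih =>
    simp only [partSum, adjoin_mark, partSum_add, select]
    congr 1
    · exact partSum_singletons deg xs _ (hpost _ _)
    rw [ih]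
    · congr 1
      funext pre σ post
      rw [join_singletons _ _ _ _ (hpost _ _), adjoin,
        join_singletons _ _ _ _ (fun ρ h => hpre ρ _ _ h), listDeg_singletons]
      simp
    · intro pre B post h
      rw [adjoin_eq_zero_of_long _ _ _ _ (fun ρ h => hpre ρ _ _ h) h, hpre _ _ _ h]
      rw [show (fun β => g pre B β) = fun β => (0 : U →+ U) 0 from
        funext fun β => hpre _ _ _ h, ← join_map]
      simp
    · intro pre B post h
      rw [join_eq_zero_of_long _ _ _ _ (hpost _ _) h, hpost _ _ _ h]
      rw [adjoin, hpost _ _ _ h, show (fun α => g α B post) = fun β => (0 : U →+ U) 0 from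
        funext fun β => hpost _ _ _ h, ← join_map]
      simp

end ListPartitions

/-! ### Families evaluated on lists -/

section Evaluation

variable {V : PointedGradedSpace.{u, v} k} {W : PointedGradedSpace.{u, w} k}
  {U : PointedGradedSpace.{u, w'} k}

/-- The value of a family on the elements of a list. -/
def Family.onList (f : Family V W) (l : List V) : W := f l.length l.get

theorem Family.onList_ofFn (f : Family V W) {n : ℕ} (x : Fin n → V) :
    f.onList (List.ofFn x) = f n x := by
  have key : ∀ (m : ℕ) (y : Fin m → V) (h : m = n), (∀ i, y i = x (Fin.cast h i)) →
      f m y = f n x := by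
    rintro m y rfl h
    congr 1
    funext i
    exact h i
  exact key _ _ List.length_ofFn fun i => by simp; rfl

theorem ofFn_update_eq_set {α : Type*} {n : ℕ} (c : Fin n → α) (i : Fin n) (b : α) :
    List.ofFn (Function.update c i b) = (List.ofFn c).set i b := by
  refine List.ext_getElem (by simp) fun j h _ => ?_
  rw [List.length_ofFn] at h
  rw [List.getElem_ofFn, List.getElem_set]
  by_cases hj : (i : ℕ) = j
  · subst hj; simp
  · rw [if_neg hj, List.getElem_ofFn, Function.update_of_ne (fun e => hj (by rw [← e]))]

theorem ofFn_update {α : Type*} {n : ℕ} (c : Fin n → α) (i : Fin n) (b : α) :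
    List.ofFn (Function.update c i b) =
      (List.ofFn c).take i ++ b :: (List.ofFn c).drop (i + 1) := by
  rw [ofFn_update_eq_set, List.set_eq_take_append_cons_drop, if_pos (by simp)]

/-- A family evaluated on a list, as a linear map in one of the entries. -/
def Family.slot (f : Family V W) (pre post : List V) : V →ₗ[k] W :=
  (f (pre ++ 0 :: post).length).toLinearMap (pre ++ 0 :: post).get ⟨pre.length, by simp⟩

theorem Family.slot_apply (f : Family V W) (pre post : List V) (a : V) :
    f.slot pre post a = f.onList (pre ++ a :: post) := by
  rw [Family.slot, MultilinearMap.toLinearMap_apply, ← f.onList_ofFn, ofFn_update,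
    List.ofFn_get]
  simp

theorem Family.onList_eq_zero (f : Family V W) {l : List V} (h : (0 : V) ∈ l) :
    f.onList l = 0 := by
  obtain ⟨pre, post, rfl⟩ := List.append_of_mem h
  rw [← f.slot_apply, map_zero]

variable {X : Type*} (deg : X → ℤ) (val : X → V)

theorem comp_eq_partSum (hv : ∀ a, val a ∈ V.deg (deg a)) (g : Family W U) (f : Family V W)
    {n : ℕ} (x : Fin n → X) :
    comp g f n (fun i => val (x i)) = partSum deg (List.ofFn x) [] fun π =>
      g.onList (π.map fun B => f.onList (B.map val)) := by
  rw [comp_apply g f n (fun i => deg (x i)) _ (fun i => hv _), partSum_ofFn]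
  refine Finset.sum_congr rfl fun π _ => ?_
  congr 1
  rw [blocks, List.map_ofFn, ← Family.onList_ofFn]
  congr 2
  funext m
  rw [Function.comp_apply, List.map_ofFn, ← Family.onList_ofFn]
  rfl

theorem onList_comp (hv : ∀ a, val a ∈ V.deg (deg a)) (g : Family W U) (f : Family V W)
    (xs : List X) :
    (comp g f).onList (xs.map val) = partSum deg xs [] fun π =>
      g.onList (π.map fun B => f.onList (B.map val)) := by
  conv_lhs => rw [← List.ofFn_get xs, List.map_ofFn, Family.onList_ofFn]
  conv_rhs => rw [← List.ofFn_get xs]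
  exact comp_eq_partSum deg val hv g f xs.get

theorem sum_update_eq_mark {n : ℕ} (p : ℤ) (g : Family W U) (F N : List X → W)
    (π : OrderedFinpartition n) (x : Fin n → X) :
    ∑ i : Fin π.length, (∏ m : Fin π.length, if m < i then
        swapSign p (∑ r : Fin (π.partSize m), deg (x (π.emb m r))) else 1) •
      g π.length (Function.update (fun j => F (List.ofFn fun r => x (π.emb j r))) i
        (N (List.ofFn fun r => x (π.emb i r)))) =
      mark (listDeg deg) p (blocks π x) fun pre B post =>
        g.onList (pre.map F ++ N B :: post.map F) := by
  rw [blocks, mark_ofFn]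
  refine Finset.sum_congr rfl fun i _ => ?_
  simp only [listDeg_ofFn]
  congr 1
  rw [← Family.onList_ofFn, ofFn_update, List.map_take, List.map_drop, List.map_ofFn]
  rfl

theorem insertion_eq_partSum (hv : ∀ a, val a ∈ V.deg (deg a)) (g : Family W U)
    (f η : Family V W) {n : ℕ} (x : Fin n → X) :
    insertion g f η n (fun i => val (x i)) = partSum deg (List.ofFn x) [] fun π =>
      mark (listDeg deg) 1 π fun pre B post =>
        g.onList (pre.map (fun B => f.onList (B.map val)) ++ η.onList (B.map val) ::
          post.map (fun B => f.onList (B.map val))) := by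
  rw [insertion_apply g f η n (fun i => deg (x i)) _ (fun i => hv _), partSum_ofFn]
  refine Finset.sum_congr rfl fun π _ => ?_
  rw [← sum_update_eq_mark deg 1 g (fun B => f.onList (B.map val))
    (fun B => η.onList (B.map val)), Finset.smul_sum]
  refine Finset.sum_congr rfl fun i _ => ?_
  rw [smul_smul, partitionSignAt]
  simp only [List.map_ofFn, Family.onList_ofFn, swapSign, one_mul]
  rfl

theorem onList_insertion (hv : ∀ a, val a ∈ V.deg (deg a)) (g : Family W U)
    (f η : Family V W) (xs : List X) :
    (insertion g f η).onList (xs.map val) = partSum deg xs [] fun π =>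
      mark (listDeg deg) 1 π fun pre B post =>
        g.onList (pre.map (fun B => f.onList (B.map val)) ++ η.onList (B.map val) ::
          post.map (fun B => f.onList (B.map val))) := by
  conv_lhs => rw [← List.ofFn_get xs, List.map_ofFn, Family.onList_ofFn]
  conv_rhs => rw [← List.ofFn_get xs]
  exact insertion_eq_partSum deg val hv g f η xs.get

theorem onList_idFamily_of_long {l : List V} (h : 2 ≤ l.length) :
    (idFamily V).onList l = 0 := by
  obtain ⟨a, b, l, rfl⟩ : ∃ a b l', l = a :: b :: l' := by
    match l, h with
    | a :: b :: l', _ => exact ⟨a, b, l', rfl⟩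
  rfl

theorem onList_idFamily_singleton (a : V) : (idFamily V).onList [a] = a := rfl

/-- The descendant relation, with the vanishing of `idFamily` on blocks of length at least two built
in. The symbols are abstract because in `K_partSum` they are themselves blocks of a partition, with
degree `listDeg deg`. -/
theorem HomotopyProbabilityAlgebra.K_onList (A : HomotopyProbabilityAlgebra V)
    (hv : ∀ a, val a ∈ V.deg (deg a)) {xs : List X} (hxs : xs ≠ []) :
    A.K (Family.onList A.M (xs.map val)) = select deg xs fun pre σ post =>
      Family.onList A.M
        (pre.map val ++ Family.onList A.descendant (σ.map val) :: post.map val) := by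
  have h : A.K (Family.onList A.M (xs.map val)) =
      (insertion A.M (idFamily V) A.descendant).onList (xs.map val) := by
    refine A.descendant_relation _ ?_ (fun i => deg (xs.get (Fin.cast (by simp) i))) _ ?_
    · rw [List.length_map]
      exact List.length_pos_iff.2 hxs
    · intro i
      have := hv (xs.get (Fin.cast (by simp) i))
      simpa using this
  rw [h, onList_insertion deg val hv, partSum_mark_singletons]
  · simp [Function.comp_def, onList_idFamily_singleton]
  · rintro pre B post ⟨D, hD, hD2⟩
    refine Family.onList_eq_zero _ (List.mem_append_left _ (List.mem_map.2 ⟨D, hD, ?_⟩))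
    exact onList_idFamily_of_long (by simpa using hD2)
  · rintro pre B post ⟨D, hD, hD2⟩
    refine Family.onList_eq_zero _ (List.mem_append_right _ (List.mem_cons_of_mem _
      (List.mem_map.2 ⟨D, hD, ?_⟩)))
    exact onList_idFamily_of_long (by simpa using hD2)

/-- The differential of a sum over partitions is a sum of insertions of `ℓᴷ ∘ φ`. -/
theorem HomotopyProbabilityAlgebra.K_partSum (A : HomotopyProbabilityAlgebra V)
    (φ : List X → V) (hφ : ∀ B, φ B ∈ V.deg (listDeg deg B)) {xs : List X} (hxs : xs ≠ []) :
    A.K (partSum deg xs [] fun π => Family.onList A.M (π.map φ)) =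
      partSum deg xs [] fun ρ => mark (listDeg deg) 1 ρ fun pre B post =>
        Family.onList A.M (pre.map φ ++
          (partSum deg B [] fun σ => Family.onList A.descendant (σ.map φ)) :: post.map φ) := by
  have h1 := partSum_map deg A.K.toAddMonoidHom xs [] (fun π => Family.onList A.M (π.map φ))
  have h2 := partSum_select deg xs fun pre σ post => Family.onList A.M
    (pre.map φ ++ Family.onList A.descendant (σ.map φ) :: post.map φ)
  -- `K` is moved inside the sum, the descendant relation is applied with the blocks of each
  -- partition as symbols, selected blocks are regrouped into a marked block, and linearity of `M`
  -- in that slot moves the inner sum inside.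
  refine h1.trans ((partSum_congr deg xs fun ρ _ hρ => ?_).trans (h2.trans ?_))
  · refine A.K_onList (listDeg deg) φ hφ ?_
    rintro rfl
    have := hρ fun _ => 1
    cases xs with
    | nil => exact hxs rfl
    | cons x xs =>
      simp [listDeg] at this
      omega
  · refine partSum_congr deg xs fun ρ _ _ => mark_congr _ _ _ fun pre B post _ => ?_
    simp only [← Family.slot_apply]
    exact (partSum_map deg (Family.slot A.M _ _).toAddMonoidHom B [] _).symm

end Evaluation

/-! ### Symmetry of sums over partitions -/

section Symmetry

variable {X : Type*} {U : Type*} [AddCommGroup U]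

/-- Invariance, up to Koszul signs, under exchanges of neighbouring blocks and of neighbouring
elements of a block. -/
structure IsKoszulSymmetric (deg : X → ℤ) (G : List (List X) → U) : Prop where
  swap_blocks : ∀ l A B r, G (l ++ A :: B :: r) =
    swapSign (listDeg deg A) (listDeg deg B) • G (l ++ B :: A :: r)
  swap_elements : ∀ l b x y b' r, G (l ++ (b ++ x :: y :: b') :: r) =
    swapSign (deg x) (deg y) • G (l ++ (b ++ y :: x :: b') :: r)

theorem IsKoszulSymmetric.cons {deg : X → ℤ} {G : List (List X) → U}
    (hG : IsKoszulSymmetric deg G) (A : List X) : IsKoszulSymmetric deg fun ρ => G (A :: ρ) :=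
  ⟨fun l => hG.swap_blocks (A :: l), fun l => hG.swap_elements (A :: l)⟩

/-- When `A` and `B` are exchanged, the terms with `z` in `A` and with `z` in `B` correspond to each
other; the sign of `z` passing the other block cancels against the changed degree of its own block.
-/
theorem IsKoszulSymmetric.adjoin {deg : X → ℤ} {G : List (List X) → U}
    (hG : IsKoszulSymmetric deg G) (z : X) :
    IsKoszulSymmetric deg fun ρ => adjoin deg z ρ G := by
  constructor
  · intro l A B r
    have h0 := hG.swap_blocks ([z] :: l) A B r
    have h1 : (fun α => G (α ++ A :: B :: r)) = fun α => _ :=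
      funext fun α => hG.swap_blocks α A B r
    have h2 := hG.swap_blocks l (z :: A) B r
    have h3 := hG.swap_blocks l A (z :: B) r
    have h4 : (fun β => G (l ++ A :: B :: β)) = fun β => _ :=
      funext fun β => hG.swap_blocks l A B β
    rw [List.cons_append, List.cons_append] at h0
    simp only [HomotopyProbability.adjoin, join_append, join]
    rw [h0, h1, h2, h3, h4]
    simp only [join_smul, smul_add, smul_smul, listDeg_cons, swapSign_add_left,
      swapSign_add_right, swapSign_comm (listDeg deg A) (deg z), mul_comm, mul_left_comm,
      mul_assoc, swapSign_mul_self_mul]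
    abel
  · intro l b x y b' r
    have h0 := hG.swap_elements ([z] :: l) b x y b' r
    have h1 : (fun α => G (α ++ (b ++ x :: y :: b') :: r)) = fun α => _ :=
      funext fun α => hG.swap_elements α b x y b' r
    have h2 := hG.swap_elements l (z :: b) x y b' r
    have h4 : (fun β => G (l ++ (b ++ x :: y :: b') :: β)) = fun β => _ :=
      funext fun β => hG.swap_elements l b x y b' β
    rw [List.cons_append, List.cons_append] at h0
    rw [List.cons_append, List.cons_append] at h2
    simp only [HomotopyProbability.adjoin, join_append, join]
    rw [h0, h1, h2, h4]
    simp only [join_smul, smul_add, smul_smul, listDeg_cons, listDeg_append,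
      swapSign_add_right, mul_comm, mul_left_comm, mul_assoc]

/-- Joining `x` and `y` to different blocks commutes up to the sign of their exchange by the
definition of `join`; only the terms with both in one block need the symmetry of `G`. -/
theorem IsKoszulSymmetric.join_join {deg : X → ℤ} {G : List (List X) → U}
    (hG : IsKoszulSymmetric deg G) (x y : X) (π : List (List X)) :
    join deg y π (fun ρ => join deg x ρ G) =
      swapSign (deg x) (deg y) • join deg x π (fun ρ => join deg y ρ G) := by
  induction π generalizing G with
  | nil => simp [join]
  | cons B π ih =>
    have h := hG.swap_elements [] [] x y B π
    simp only [List.nil_append] at h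
    simp only [join, join_add, join_smul, ih (hG.cons B), h, listDeg_cons, swapSign_add_right,
      swapSign_comm (deg y) (deg x), smul_add, smul_smul, mul_comm, mul_assoc,
      swapSign_mul_self_mul]
    abel

/-- Two new singleton blocks are exchanged by `swap_blocks`, a new block made of both elements by
`swap_elements`; the terms with exactly one new singleton match directly. -/
theorem IsKoszulSymmetric.adjoin_adjoin {deg : X → ℤ} {G : List (List X) → U}
    (hG : IsKoszulSymmetric deg G) (x y : X) (π : List (List X)) :
    HomotopyProbability.adjoin deg y π (fun ρ => HomotopyProbability.adjoin deg x ρ G) =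
      swapSign (deg x) (deg y) •
        HomotopyProbability.adjoin deg x π (fun ρ => HomotopyProbability.adjoin deg y ρ G) := by
  have h1 := hG.swap_blocks [] [x] [y] π
  have h2 := hG.swap_elements [] [] x y [] π
  simp only [List.nil_append, listDeg_cons, listDeg_nil, add_zero] at h1 h2
  simp only [HomotopyProbability.adjoin, join, join_add, hG.join_join x y, h1, h2, smul_add,
    listDeg_cons, listDeg_nil, add_zero, smul_smul, swapSign_comm (deg y) (deg x),
    swapSign_mul_self, one_smul]
  abel

/-- A sum over partitions of a symmetric function is symmetric. -/
theorem IsKoszulSymmetric.partSum {deg : X → ℤ} {G : List (List X) → U}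
    (hG : IsKoszulSymmetric deg G) (l : List X) (x y : X) (r : List X) (π : List (List X)) :
    partSum deg (l ++ x :: y :: r) π G =
      swapSign (deg x) (deg y) • partSum deg (l ++ y :: x :: r) π G := by
  induction l generalizing G with
  | nil =>
    simp only [List.nil_append, HomotopyProbability.partSum]
    rw [← partSum_smul]
    congr 1
    funext ρ
    exact hG.adjoin_adjoin x y ρ
  | cons z l ih => exact ih (hG.adjoin z)

end Symmetry

/-! ### Koszul signs of permutations -/

section KoszulSign

/-- A symmetric function is a function on unordered pairs, which `σ` permutes. The auxiliary map `e`
lists the image of a pair in increasing order. -/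
theorem prod_lt_comp_perm {n : ℕ} {α : Type*} [CommMonoid α] (H : Fin n → Fin n → α)
    (hH : ∀ i j, H i j = H j i) (σ : Equiv.Perm (Fin n)) :
    ∏ i, ∏ j, (if i < j then H (σ i) (σ j) else 1) = ∏ i, ∏ j, if i < j then H i j else 1 := by
  have key : ∀ F : Fin n → Fin n → α, ∏ i, ∏ j, (if i < j then F i j else 1) =
      ∏ p ∈ (Finset.univ : Finset (Fin n × Fin n)).filter (fun p => p.1 < p.2), F p.1 p.2 := by
    intro F
    rw [Finset.prod_filter, ← Finset.univ_product_univ, Finset.prod_product]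
  rw [key, key]
  let e : Equiv.Perm (Fin n) → Fin n × Fin n → Fin n × Fin n := fun τ p =>
    if τ p.1 < τ p.2 then (τ p.1, τ p.2) else (τ p.2, τ p.1)
  have hmem : ∀ (τ : Equiv.Perm (Fin n)) (p : Fin n × Fin n), p.1 < p.2 →
      (e τ p).1 < (e τ p).2 := by
    intro τ p hp
    have hne : τ p.1 ≠ τ p.2 := fun h => hp.ne (τ.injective h)
    by_cases h : τ p.1 < τ p.2
    · simp [e, h]
    · simpa [e, h] using lt_of_le_of_ne (not_lt.1 h) hne.symm
  have hinv : ∀ (τ : Equiv.Perm (Fin n)) (p : Fin n × Fin n), p.1 < p.2 →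
      e τ⁻¹ (e τ p) = p := by
    intro τ p hp
    by_cases h : τ p.1 < τ p.2
    · simp [e, h, hp]
    · simp [e, h, not_lt.2 hp.le]
  refine Finset.prod_bij' (fun p _ => e σ p) (fun p _ => e σ⁻¹ p) ?_ ?_ ?_ ?_ ?_
  · intro p hp
    rw [Finset.mem_filter_univ] at hp ⊢
    exact hmem σ p hp
  · intro p hp
    rw [Finset.mem_filter_univ] at hp ⊢
    exact hmem σ⁻¹ p hp
  · intro p hp
    exact hinv σ p (by simpa using hp)
  · intro p hp
    simpa using hinv σ⁻¹ p (by simpa using hp)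
  · intro p hp
    by_cases h : σ p.1 < σ p.2
    · simp [e, h]
    · simp only [e, h, if_false]
      exact hH _ _

/-- A pair is exchanged by the product iff exactly one of the two steps exchanges it; a pair
exchanged twice contributes a square, which is `1`. The factor of `τ` is reindexed along `σ` so that
both products run over the same pairs. Together with `koszulSign_swap` this reduces symmetry to
neighbouring transpositions. -/
theorem koszulSign_mul {n : ℕ} (d : Fin n → ℤ) (σ τ : Equiv.Perm (Fin n)) :
    koszulSign d (σ * τ).symm =
      koszulSign d σ.symm * koszulSign (fun i => d (σ i)) τ.symm := by
  have h := prod_lt_comp_perm (fun i j : Fin n =>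
    if (σ.symm i < σ.symm j ↔ τ.symm (σ.symm i) < τ.symm (σ.symm j)) then (1 : ℤˣ)
      else Int.negOnePow (d i * d j)) ?_ σ
  · have h' : koszulSign (fun i => d (σ i)) τ.symm = ∏ i : Fin n, ∏ j : Fin n,
        if i < j then (if (σ.symm i < σ.symm j ↔ τ.symm (σ.symm i) < τ.symm (σ.symm j))
          then (1 : ℤˣ) else Int.negOnePow (d i * d j)) else 1 := by
      rw [← h, koszulSign]
      refine Finset.prod_congr rfl fun i _ => Finset.prod_congr rfl fun j _ => ?_
      by_cases hij : i < j
      · have hne : τ.symm i ≠ τ.symm j := fun h => hij.ne (τ.symm.injective h)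
        simp only [hij, Equiv.symm_apply_apply, true_and, true_iff, if_true]
        by_cases h2 : τ.symm j < τ.symm i
        · simp [h2, not_lt.2 h2.le]
        · simp [h2, lt_of_le_of_ne (not_lt.1 h2) hne]
      · simp [hij]
    rw [h', koszulSign, koszulSign, ← Finset.prod_mul_distrib]
    refine Finset.prod_congr rfl fun i _ => ?_
    rw [← Finset.prod_mul_distrib]
    refine Finset.prod_congr rfl fun j _ => ?_
    by_cases hij : i < j
    · have hne : σ.symm i ≠ σ.symm j := fun h => hij.ne (σ.symm.injective h)
      have hne' : τ.symm (σ.symm i) ≠ τ.symm (σ.symm j) := fun h => hne (τ.symm.injective h)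
      have e : ∀ a : Fin n, (σ * τ).symm a = τ.symm (σ.symm a) := fun _ => rfl
      simp only [hij, true_and, if_true, e]
      rcases lt_or_gt_of_ne hne with h1 | h1 <;> rcases lt_or_gt_of_ne hne' with h2 | h2 <;>
        simp [h1, h2, not_lt.2 h1.le, not_lt.2 h2.le, Int.units_mul_self]
    · simp [hij]
  · intro i j
    rw [mul_comm (d i)]
    by_cases hij : i = j
    · subst hij; rfl
    have hne : σ.symm i ≠ σ.symm j := fun h => hij (σ.symm.injective h)
    have hne' : τ.symm (σ.symm i) ≠ τ.symm (σ.symm j) := fun h => hne (τ.symm.injective h)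
    rcases lt_or_gt_of_ne hne with h1 | h1 <;> rcases lt_or_gt_of_ne hne' with h2 | h2 <;>
        simp [h1, h2, not_lt.2 h1.le, not_lt.2 h2.le]

theorem koszulSign_swap {n : ℕ} (d : Fin (n + 1) → ℤ) (i : Fin n) :
    koszulSign d (Equiv.swap i.castSucc i.succ).symm = swapSign (d i.castSucc) (d i.succ) := by
  have key : ∀ a b : Fin (n + 1), (a < b ∧ Equiv.swap i.castSucc i.succ b <
      Equiv.swap i.castSucc i.succ a) ↔ a = i.castSucc ∧ b = i.succ := by
    intro a b
    simp only [Equiv.swap_apply_def, Fin.lt_def, Fin.ext_iff]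
    split_ifs with h1 h2 h3 h4 h5 <;> simp_all <;> omega
  rw [koszulSign, Equiv.symm_swap]
  simp only [key]
  rw [Finset.prod_eq_single i.castSucc, Finset.prod_eq_single i.succ]
  · simp [swapSign]
  · intro b _ hb; simp [hb]
  · simp
  · intro b _ hb; simp [hb]
  · simp

@[simp] theorem koszulSign_one {n : ℕ} (d : Fin n → ℤ) :
    koszulSign d (1 : Equiv.Perm (Fin n)).symm = 1 := by
  refine Finset.prod_eq_one fun i _ => Finset.prod_eq_one fun j _ => if_neg ?_
  rintro ⟨h1, h2⟩
  exact lt_asymm h1 h2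

end KoszulSign

/-! ### Homogeneous arguments -/

section Homogeneous

variable {V : PointedGradedSpace.{u, v} k} {W : PointedGradedSpace.{u, w} k}
  {U : PointedGradedSpace.{u, w'} k}

theorem multilinearMap_ext_homogeneous {E : Type*} [AddCommGroup E] [Module k E] {n : ℕ}
    {f g : MultilinearMap k (fun _ : Fin n => V) E}
    (h : ∀ (d : Fin n → ℤ) (x : Fin n → V), (∀ i, x i ∈ V.deg (d i)) → f x = g x) : f = g := by
  classical
  ext x
  have hx : x = fun i => ∑ j ∈ (DirectSum.decompose V.deg (x i)).support,
      (DirectSum.decompose V.deg (x i) j : V) :=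
    funext fun i => (DirectSum.sum_support_decompose V.deg (x i)).symm
  rw [hx, MultilinearMap.map_sum_finset, MultilinearMap.map_sum_finset]
  exact Finset.sum_congr rfl fun r _ => h r _ fun i => SetLike.coe_mem _

variable (V) in
/-- A homogeneous element together with its degree. -/
abbrev HomogeneousElement := Σ j : ℤ, V.deg j

/-- The underlying element. -/
def HomogeneousElement.val (a : HomogeneousElement V) : V := a.2

theorem HomogeneousElement.val_mem (a : HomogeneousElement V) : a.val ∈ V.deg a.1 := a.2.2

theorem exists_homogeneousElement {n : ℕ} (d : Fin n → ℤ) (x : Fin n → V)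
    (hx : ∀ i, x i ∈ V.deg (d i)) : ∃ y : Fin n → HomogeneousElement V,
      (x = fun i => (y i).val) ∧ d = fun i => (y i).1 :=
  ⟨fun i => ⟨d i, ⟨x i, hx i⟩⟩, rfl, rfl⟩

theorem ofFn_comp_swap {α : Type*} {n : ℕ} (x : Fin (n + 1) → α) (i : Fin n) :
    ∃ l r : List α, l.length = i ∧
      List.ofFn x = l ++ x i.castSucc :: x i.succ :: r ∧
      List.ofFn (fun j => x (Equiv.swap i.castSucc i.succ j)) =
        l ++ x i.succ :: x i.castSucc :: r := by
  have split : ∀ z : Fin (n + 1) → α, List.ofFn z = (List.ofFn z).take i ++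
      z i.castSucc :: z i.succ :: (List.ofFn z).drop (i + 2) := by
    intro z
    have h1 : (i : ℕ) < (List.ofFn z).length := by simp
    have h2 : (i : ℕ) + 1 < (List.ofFn z).length := by simp
    conv_lhs => rw [← List.take_append_drop i (List.ofFn z), List.drop_eq_getElem_cons h1,
      List.drop_eq_getElem_cons h2, List.getElem_ofFn, List.getElem_ofFn]
    rfl
  refine ⟨(List.ofFn x).take i, (List.ofFn x).drop (i + 2), by simp; omega, split x, ?_⟩
  rw [split fun j => x (Equiv.swap i.castSucc i.succ j)]
  simp only [Equiv.swap_apply_left, Equiv.swap_apply_right]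
  congr 1
  · refine List.ext_getElem (by simp) fun j h1 h2 => ?_
    simp only [List.length_take, List.length_ofFn] at h1
    simp only [List.getElem_take, List.getElem_ofFn]
    rw [Equiv.swap_apply_of_ne_of_ne] <;> simp [Fin.ext_iff] <;> omega
  · congr 2
    refine List.ext_getElem (by simp) fun j h1 h2 => ?_
    simp only [List.getElem_drop, List.getElem_ofFn]
    rw [Equiv.swap_apply_of_ne_of_ne] <;> simp [Fin.ext_iff] <;> omega

theorem exists_ofFn_eq {α : Type*} (l : List α) {n : ℕ} (h : l.length = n) :
    ∃ x : Fin n → α, List.ofFn x = l := by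
  subst h
  exact ⟨l.get, List.ofFn_get l⟩

variable {X : Type*} {deg : X → ℤ} {val : X → V}

theorem Family.onList_map_ofFn (f : Family V W) {n : ℕ} (x : Fin n → X) :
    f.onList ((List.ofFn x).map val) = f n fun i => val (x i) := by
  rw [List.map_ofFn, f.onList_ofFn]
  rfl

theorem IsSymmetricOfDegree.onList_mem {p : ℤ} {f : Family V W} (hf : IsSymmetricOfDegree p f)
    (hv : ∀ a, val a ∈ V.deg (deg a)) {xs : List X} (hxs : xs ≠ []) :
    f.onList (xs.map val) ∈ W.deg (listDeg deg xs + p) := by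
  obtain ⟨x, hx⟩ := exists_ofFn_eq xs rfl
  rw [← hx, f.onList_map_ofFn, listDeg_ofFn]
  exact hf.mem_deg _ (List.length_pos_iff.2 hxs) _ _ fun i => hv _

theorem IsSymmetricOfDegree.onList_swap {p : ℤ} {f : Family V W}
    (hf : IsSymmetricOfDegree p f) (hv : ∀ a, val a ∈ V.deg (deg a)) (l : List X) (a b : X)
    (r : List X) : f.onList ((l ++ a :: b :: r).map val) =
      swapSign (deg a) (deg b) • f.onList ((l ++ b :: a :: r).map val) := by
  obtain ⟨x, hx⟩ := exists_ofFn_eq (l ++ a :: b :: r) (n := l.length + 1 + r.length + 1)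
    (by simp; omega)
  obtain ⟨l', r', hl, h1, h2⟩ := ofFn_comp_swap x
    (⟨l.length, by omega⟩ : Fin (l.length + 1 + r.length))
  rw [hx] at h1
  obtain ⟨rfl, h3⟩ := List.append_inj h1 hl.symm
  simp only [List.cons.injEq] at h3
  obtain ⟨ha, hb, rfl⟩ := h3
  rw [← ha, ← hb] at h2
  rw [← h2, ← hx, f.onList_map_ofFn, f.onList_map_ofFn,
    hf.symm _ (by omega) (Equiv.swap _ _) (fun i => deg (x i)) _ (fun i => hv _),
    koszulSign_swap, ← ha, ← hb]

/-- Symmetry under exchanges of neighbours is symmetry. -/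
theorem symm_of_onList_swap {f : Family V W}
    (h : ∀ (l : List (HomogeneousElement V)) (a b : HomogeneousElement V)
      (r : List (HomogeneousElement V)),
      f.onList ((l ++ a :: b :: r).map HomogeneousElement.val) =
        swapSign a.1 b.1 • f.onList ((l ++ b :: a :: r).map HomogeneousElement.val))
    (n : ℕ) (σ : Equiv.Perm (Fin n)) (d : Fin n → ℤ) (x : Fin n → V)
    (hx : ∀ i, x i ∈ V.deg (d i)) :
    f n x = koszulSign d σ.symm • f n (fun i => x (σ i)) := by
  cases n with
  | zero =>
    rw [Subsingleton.elim σ 1, koszulSign_one, one_smul]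
    rfl
  | succ n =>
    have hσ : σ ∈ Submonoid.closure
        (Set.range fun i : Fin n => Equiv.swap i.castSucc i.succ) := by
      rw [Equiv.Perm.mclosure_swap_castSucc_succ]; trivial
    induction hσ using Submonoid.closure_induction generalizing d x with
    | mem σ hσ =>
      obtain ⟨i, rfl⟩ := hσ
      obtain ⟨y, rfl, rfl⟩ := exists_homogeneousElement d x hx
      obtain ⟨l, r, -, h1, h2⟩ := ofFn_comp_swap y i
      have := h l (y i.castSucc) (y i.succ) r
      rw [← h1, ← h2, f.onList_map_ofFn, f.onList_map_ofFn] at this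
      simp only [koszulSign_swap]
      exact this
    | one => rw [koszulSign_one, one_smul]; rfl
    | mul σ τ _ _ hσ hτ =>
      rw [koszulSign_mul, mul_smul, hσ d x hx, hτ (fun i => d (σ i)) _ fun i => hx _]
      rfl

/-- The value of a family on a block, with the value `0` on the empty block. -/
def Family.onBlock (f : Family V W) (val : X → V) (B : List X) : W :=
  if B = [] then 0 else f.onList (B.map val)

@[simp] theorem Family.onBlock_nil (f : Family V W) (val : X → V) : f.onBlock val [] = 0 :=
  if_pos rfl

theorem Family.onBlock_of_ne_nil (f : Family V W) (val : X → V) {B : List X} (hB : B ≠ []) :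
    f.onBlock val B = f.onList (B.map val) := if_neg hB

/-- The value `0` on the empty block makes the degree statement hold for all blocks, as the list
lemmas require; the entry `f 0` of a family is not constrained. -/
theorem IsSymmetricOfDegree.onBlock_mem {f : Family V W} (hf : IsSymmetricOfDegree 0 f)
    (hv : ∀ a, val a ∈ V.deg (deg a)) (B : List X) :
    f.onBlock val B ∈ W.deg (listDeg deg B) := by
  by_cases hB : B = []
  · subst hB; simp
  · rw [f.onBlock_of_ne_nil val hB]
    simpa using hf.onList_mem hv hB

theorem IsSymmetricOfDegree.onBlock_swap {f : Family V W} (hf : IsSymmetricOfDegree 0 f)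
    (hv : ∀ a, val a ∈ V.deg (deg a)) (l : List X) (a b : X) (r : List X) :
    f.onBlock val (l ++ a :: b :: r) =
      swapSign (deg a) (deg b) • f.onBlock val (l ++ b :: a :: r) := by
  rw [f.onBlock_of_ne_nil val (by simp), f.onBlock_of_ne_nil val (by simp), hf.onList_swap hv]

theorem onList_comp_eq_onBlock (hv : ∀ a, val a ∈ V.deg (deg a)) (g : Family W U)
    (f : Family V W) (xs : List X) :
    (comp g f).onList (xs.map val) =
      partSum deg xs [] fun π => g.onList (π.map (f.onBlock val)) := by
  rw [onList_comp deg val hv]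
  refine partSum_congr deg xs fun ρ hρ _ => ?_
  congr 1
  exact List.map_congr_left fun B hB => (f.onBlock_of_ne_nil val (hρ B hB)).symm

theorem Family.onList_units_smul (f : Family V W) (l r : List V) (c : ℤˣ) (a : V) :
    f.onList (l ++ (c • a) :: r) = c • f.onList (l ++ a :: r) := by
  rw [← f.slot_apply, ← f.slot_apply, Units.smul_def, map_zsmul, Units.smul_def]

/-- The composite of symmetric families of degree `0` is symmetric of degree `0`. -/
theorem IsSymmetricOfDegree.comp {g : Family W U} {f : Family V W}
    (hg : IsSymmetricOfDegree 0 g) (hf : IsSymmetricOfDegree 0 f) :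
    IsSymmetricOfDegree 0 (comp g f) := by
  have hv := HomogeneousElement.val_mem (V := V)
  have hφ := hf.onBlock_mem hv
  constructor
  · intro n hn d x hx
    obtain ⟨y, rfl, rfl⟩ := exists_homogeneousElement d x hx
    rw [← Family.onList_map_ofFn, onList_comp_eq_onBlock hv]
    refine partSum_mem _ _ _ fun ρ hρ hρ' => ?_
    have hρ0 : ρ ≠ [] := by
      rintro rfl
      have := hρ' fun _ => 1
      simp [listDeg_ofFn] at this
      omega
    have := hg.onList_mem hφ hρ0
    rwa [hρ' Sigma.fst, listDeg_ofFn] at this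
  · intro n _
    -- Symmetry of `g` provides the exchange of blocks, symmetry of `f` the exchange of elements
    -- inside a block.
    refine symm_of_onList_swap (fun l a b r => ?_) n
    rw [onList_comp_eq_onBlock hv, onList_comp_eq_onBlock hv]
    refine IsKoszulSymmetric.partSum ⟨fun l A B r => hg.onList_swap hφ l A B r,
      fun l c x y c' r => ?_⟩ l a b r []
    rw [List.map_append, List.map_append, List.map_cons, List.map_cons, hf.onBlock_swap hv,
      Family.onList_units_smul]

theorem IsSymmetricOfDegree.compLinear {p : ℤ} {f : Family V W}
    (hf : IsSymmetricOfDegree 0 f) {h : W →ₗ[k] U} (hh : HasDegree p h) :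
    IsSymmetricOfDegree p fun n => h.compMultilinearMap (f n) := by
  constructor
  · intro n hn d x hx
    have := hh _ _ (hf.mem_deg n hn d x hx)
    rwa [add_zero] at this
  · intro n hn σ d x hx
    rw [LinearMap.compMultilinearMap_apply, hf.symm n hn σ d x hx, Units.smul_def, map_zsmul,
      Units.smul_def]
    rfl

end Homogeneous

/-! ### Units -/

section Unital

variable {X : Type*} {E : Type*} [AddCommGroup E]

theorem join_congr_of_length (deg : X → ℤ) (x : X) (π : List (List X))
    {G G' : List (List X) → E} (h : ∀ α, α.length = π.length → G α = G' α) :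
    join deg x π G = join deg x π G' := by
  induction π generalizing G G' with
  | nil => rfl
  | cons B π ih =>
    rw [join, join, h _ (by simp), ih fun α hα => h _ (by simp [hα])]

/-- The unit is the last symbol, so its block stays last. Elements added later either leave `[e]`
alone, and then `H` forgets it, or enter its block, and then `H` vanishes. Both properties of `H`
are inherited by `adjoin`, which gives the induction. -/
theorem partSum_snoc_unit_aux (deg : X → ℤ) (e : X) (xs : List X) (H : List (List X) → E)
    (h1 : ∀ π B, B ≠ [] → H (π ++ [B ++ [e]]) = 0) (h2 : ∀ π, H (π ++ [[e]]) = H π)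
    (π : List (List X)) : partSum deg xs (π ++ [[e]]) H = partSum deg xs π H := by
  induction xs generalizing H with
  | nil => exact h2 π
  | cons x xs ih =>
    refine ih _ (fun π B hB => ?_) fun π => ?_
    · rw [adjoin, join_append]
      simp only [join, smul_zero, add_zero]
      have e1 : H ([x] :: (π ++ [B ++ [e]])) = 0 := h1 ([x] :: π) B hB
      have e2 : H (π ++ [x :: (B ++ [e])]) = 0 := h1 π (x :: B) (by simp)
      rw [e1, e2, join_congr_of_length deg x π (G' := fun _ => (0 : E →+ E) 0)
        (fun α _ => h1 α B hB), ← join_map]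
      simp
    · rw [adjoin, join_append]
      simp only [join, smul_zero, add_zero]
      have e1 : H ([x] :: (π ++ [[e]])) = H ([x] :: π) := h2 ([x] :: π)
      have e2 : H (π ++ [[x, e]]) = 0 := h1 π [x] (by simp)
      rw [e1, e2, smul_zero, add_zero, adjoin]
      congr 2
      exact funext h2

theorem partSum_snoc_unit (deg : X → ℤ) (e : X) {xs : List X} (hxs : xs ≠ [])
    (H : List (List X) → E) (h1 : ∀ π B, B ≠ [] → H (π ++ [B ++ [e]]) = 0)
    (h2 : ∀ π, π ≠ [] → H (π ++ [[e]]) = H π) :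
    partSum deg (xs ++ [e]) [] H = partSum deg xs [] H := by
  rw [partSum_append]
  obtain ⟨x, xs, rfl⟩ := List.exists_cons_of_ne_nil hxs
  -- Here `H` may drop `[e]` only next to another block, because the unit axiom of `M` starts at `n
  -- = 1`. Absorbing one element `x` into the function removes this restriction: after adjoining `x`
  -- there is always another block, or `x` shares the block of `e`.
  have key := partSum_snoc_unit_aux deg e xs (fun ρ => adjoin deg x ρ H) ?_ ?_ []
  · simpa [partSum, adjoin, join] using key
  · intro π B hB
    rw [adjoin, join_append]
    simp only [join, smul_zero, add_zero]
    have e1 : H ([x] :: (π ++ [B ++ [e]])) = 0 := h1 ([x] :: π) B hB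
    have e2 : H (π ++ [x :: (B ++ [e])]) = 0 := h1 π (x :: B) (by simp)
    rw [e1, e2, join_congr_of_length deg x π (G' := fun _ => (0 : E →+ E) 0)
      (fun α _ => h1 α B hB), ← join_map]
    simp
  · intro π
    rw [adjoin, join_append]
    simp only [join, smul_zero, add_zero]
    have e1 : H ([x] :: (π ++ [[e]])) = H ([x] :: π) := h2 ([x] :: π) (by simp)
    have e2 : H (π ++ [[x, e]]) = 0 := h1 π [x] (by simp)
    rw [e1, e2, smul_zero, add_zero, adjoin]
    congr 1
    cases π with
    | nil => rfl
    | cons B π =>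
      refine join_congr_of_length deg x _ fun α hα => h2 α ?_
      rintro rfl
      simp at hα

variable {V : PointedGradedSpace.{u, v} k} {W : PointedGradedSpace.{u, w} k}
  {U : PointedGradedSpace.{u, w'} k}

theorem ofFn_appendOne {n : ℕ} (x : Fin n → V) :
    List.ofFn (appendOne x) = List.ofFn x ++ [V.one] := by
  rw [List.ofFn_succ', List.concat_eq_append]
  simp [appendOne]

theorem Family.onList_append_one (f : Family V W) (l : List V) :
    f.onList (l ++ [V.one]) = f (l.length + 1) (appendOne l.get) := by
  rw [← f.onList_ofFn, ofFn_appendOne, List.ofFn_get]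

theorem Family.onList_append_one_eq_zero {f : Family V W}
    (hf : ∀ n : ℕ, 1 ≤ n → ∀ x : Fin n → V, f (n + 1) (appendOne x) = 0) {l : List V}
    (hl : l ≠ []) : f.onList (l ++ [V.one]) = 0 := by
  rw [f.onList_append_one]
  exact hf _ (List.length_pos_iff.2 hl) _

theorem Family.onList_append_one_eq {f : Family V W}
    (hf : ∀ n : ℕ, 1 ≤ n → ∀ x : Fin n → V, f (n + 1) (appendOne x) = f n x) {l : List V}
    (hl : l ≠ []) : f.onList (l ++ [V.one]) = f.onList l := by
  rw [f.onList_append_one]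
  exact hf _ (List.length_pos_iff.2 hl) _

theorem Family.linearPart_apply (f : Family V W) (a : V) : f.linearPart a = f.onList [a] := by
  rw [Family.linearPart, Family.onList]
  change f 1 (fun _ => a) = f 1 [a].get
  congr 1
  funext i
  rw [Subsingleton.elim i 0]
  rfl

theorem Family.linearPart_eq (f : Family V W) (x : Fin 1 → V) : f 1 x = f.linearPart (x 0) := by
  rw [f.linearPart_apply, ← f.onList_ofFn]
  simp

/-- Appending the unit to the arguments of a composite. -/
theorem comp_appendOne {g : Family W U} {f : Family V W}
    (hg : ∀ n : ℕ, 1 ≤ n → ∀ x : Fin n → W, g (n + 1) (appendOne x) = g n x)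
    (hf1 : f.linearPart V.one = W.one)
    (hf : ∀ n : ℕ, 1 ≤ n → ∀ x : Fin n → V, f (n + 1) (appendOne x) = 0)
    {n : ℕ} (hn : 1 ≤ n) (x : Fin n → V) :
    comp g f (n + 1) (appendOne x) = comp g f n x := by
  -- Both sides are treated as multilinear maps of `x`, so that homogeneous arguments suffice.
  have key : (LinearMap.applyₗ (R := k) V.one).compMultilinearMap
      (comp g f (n + 1)).curryRight = comp g f n := by
    refine multilinearMap_ext_homogeneous fun d x hx => ?_
    change comp g f (n + 1) (appendOne x) = _
    obtain ⟨y, rfl, -⟩ := exists_homogeneousElement d x hx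
    have hv := HomogeneousElement.val_mem (V := V)
    let e : HomogeneousElement V := ⟨0, ⟨V.one, V.one_mem⟩⟩
    have h1 : List.ofFn (appendOne fun i => (y i).val) =
        (List.ofFn y ++ [e]).map HomogeneousElement.val := by
      rw [ofFn_appendOne, List.map_append, List.map_ofFn]
      rfl
    have hy : List.ofFn y ≠ [] := by
      intro h
      have := congrArg List.length h
      simp at this
      omega
    rw [← Family.onList_ofFn, h1, ← Family.onList_map_ofFn, onList_comp_eq_onBlock hv,
      onList_comp_eq_onBlock hv]
    refine partSum_snoc_unit _ e hy _ (fun π B hB => ?_) fun π hπ => ?_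
    · refine g.onList_eq_zero ?_
      have : f.onBlock HomogeneousElement.val (B ++ [e]) = 0 := by
        rw [f.onBlock_of_ne_nil _ (by simp), List.map_append]
        exact Family.onList_append_one_eq_zero hf (by simpa using hB)
      simp [this]
    · have : f.onBlock HomogeneousElement.val [e] = W.one := by
        rw [f.onBlock_of_ne_nil _ (by simp), ← hf1, Family.linearPart_apply]
        rfl
      rw [List.map_append, List.map_cons, this, List.map_nil]
      exact Family.onList_append_one_eq hg (by simpa using hπ)
  exact congrArg (fun F => F x) key

end Unital

/-! ### Polynomial functions and their derivatives -/

section PolynomialDerivative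

variable {E F : Type*} [AddCommGroup E] [Module k E] [AddCommGroup F] [Module k F]

theorem HasPolynomialDerivative.zero :
    HasPolynomialDerivative (k := k) (fun _ => (0 : E)) (fun _ => 0) :=
  ⟨0, fun _ => by simp, fun _ => by simp⟩

theorem HasPolynomialDerivative.add {c c' b b' : k → E} (hc : HasPolynomialDerivative c c')
    (hb : HasPolynomialDerivative b b') :
    HasPolynomialDerivative (fun τ => c τ + b τ) (fun τ => c' τ + b' τ) := by
  obtain ⟨p, hp, hp'⟩ := hc
  obtain ⟨q, hq, hq'⟩ := hb
  refine ⟨p + q, fun τ => ?_, fun τ => ?_⟩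
  · simp only [hp, hq]
    rw [Finsupp.sum_add_index' (by simp) (by simp [smul_add])]
  · simp only [hp', hq']
    rw [Finsupp.sum_add_index' (by simp) (by simp [smul_add])]

theorem HasPolynomialDerivative.map {c c' : k → E} (hc : HasPolynomialDerivative c c')
    (f : E →ₗ[k] F) : HasPolynomialDerivative (fun τ => f (c τ)) (fun τ => f (c' τ)) := by
  obtain ⟨p, hp, hp'⟩ := hc
  refine ⟨p.mapRange f (map_zero f), fun τ => ?_, fun τ => ?_⟩
  · simp only [hp]
    rw [Finsupp.sum_mapRange_index (by simp), map_finsuppSum]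
    simp only [map_smul]
  · simp only [hp']
    rw [Finsupp.sum_mapRange_index (by simp), map_finsuppSum]
    simp only [map_smul]

theorem HasPolynomialDerivative.units_smul {c c' : k → E} (hc : HasPolynomialDerivative c c')
    (s : ℤˣ) : HasPolynomialDerivative (fun τ => s • c τ) (fun τ => s • c' τ) := by
  have := hc.map (((s : ℤ) : k) • LinearMap.id)
  simpa [Units.smul_def, Int.cast_smul_eq_zsmul] using this

theorem HasPolynomialDerivative.monomial (j : ℕ) (a : E) :
    HasPolynomialDerivative (fun τ : k => τ ^ j • a)
      (fun τ : k => ((j : k) * τ ^ (j - 1)) • a) :=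
  ⟨Finsupp.single j a, fun τ => by simp, fun τ => by simp⟩

theorem HasPolynomialDerivative.sum {ι : Type*} (s : Finset ι) {c c' : ι → k → E}
    (h : ∀ i ∈ s, HasPolynomialDerivative (c i) (c' i)) :
    HasPolynomialDerivative (fun τ => ∑ i ∈ s, c i τ) (fun τ => ∑ i ∈ s, c' i τ) := by
  classical
  induction s using Finset.induction_on with
  | empty => simpa using HasPolynomialDerivative.zero
  | insert i s hi ih =>
    simp only [Finset.sum_insert hi]
    exact (h i (by simp)).add (ih fun j hj => h j (by simp [hj]))

theorem sum_prod_derivative {r : ℕ} (J : Fin r → ℕ) (τ : k) :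
    ∑ i, ∏ m, (if m = i then (J m : k) * τ ^ (J m - 1) else τ ^ J m) =
      ((∑ i, J i : ℕ) : k) * τ ^ (∑ i, J i - 1) := by
  rw [Nat.cast_sum, Finset.sum_mul]
  refine Finset.sum_congr rfl fun i _ => ?_
  rw [← Finset.mul_prod_erase _ _ (Finset.mem_univ i), if_pos rfl, mul_assoc]
  -- For `J i = 0` the exponent `J i - 1` is truncated, but the coefficient vanishes.
  by_cases h : J i = 0
  · simp [h]
  congr 1
  rw [Finset.prod_congr rfl fun m hm => if_neg (Finset.ne_of_mem_erase hm),
    Finset.prod_pow_eq_pow_sum, ← pow_add, ← Finset.add_sum_erase _ J (Finset.mem_univ i)]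
  congr 1
  omega

/-- The product rule. -/
theorem HasPolynomialDerivative.multilinear {r : ℕ} (g : MultilinearMap k (fun _ : Fin r => E) F)
    {c c' : Fin r → k → E} (h : ∀ i, HasPolynomialDerivative (c i) (c' i)) :
    HasPolynomialDerivative (fun τ => g fun i => c i τ)
      (fun τ => ∑ i, g (Function.update (fun j => c j τ) i (c' i τ))) := by
  classical
  choose p hp hp' using h
  -- Multilinear expansion in the coefficients of the `c i`: a choice `J` of exponents contributes
  -- one monomial of exponent `∑ J i`, so the product rule reduces to `sum_prod_derivative`.
  have key := HasPolynomialDerivative.sum (Fintype.piFinset fun i => (p i).support)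
    (c := fun J τ => τ ^ (∑ i, J i) • g fun i => p i (J i)) (fun J _ =>
      HasPolynomialDerivative.monomial (k := k) (∑ i, J i) (g fun i => p i (J i)))
  convert key using 2 with τ τ
  · simp only [hp, Finsupp.sum]
    rw [MultilinearMap.map_sum_finset]
    refine Finset.sum_congr rfl fun J _ => ?_
    rw [g.map_smul_univ (fun i => τ ^ J i) (fun i => p i (J i)), Finset.prod_pow_eq_pow_sum]
  · simp only [← sum_prod_derivative, Finset.sum_smul]
    rw [Finset.sum_comm]
    refine Finset.sum_congr rfl fun i _ => ?_
    have : Function.update (fun j => c j τ) i (c' i τ) = fun m => ∑ j ∈ (p m).support,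
        (if m = i then (j : k) * τ ^ (j - 1) else τ ^ j) • p m j := by
      funext m
      by_cases hm : m = i
      · subst hm; simp [hp', Finsupp.sum]
      · simp [hm, hp, Finsupp.sum]
    rw [this, MultilinearMap.map_sum_finset]
    refine Finset.sum_congr rfl fun J _ => ?_
    rw [← g.map_smul_univ]

/-- Linear functionals reduce the claim to scalar polynomials. Characteristic zero enters twice: the
field is infinite, so a polynomial vanishing as a function is zero, and a polynomial with zero
derivative is constant. -/
theorem HasPolynomialDerivative.eq_of_deriv_eq_zero [CharZero k] {c : k → E}
    (h : HasPolynomialDerivative c fun _ => 0) (σ τ : k) : c σ = c τ := by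
  obtain ⟨p, hp, hp'⟩ := h
  rw [← sub_eq_zero, ← Module.forall_dual_apply_eq_zero_iff k]
  intro f
  let P : Polynomial k := p.sum fun j w => Polynomial.C (f w) * Polynomial.X ^ j
  have hP : ∀ τ, P.eval τ = f (c τ) := by
    intro τ
    rw [hp, map_finsuppSum]
    simp only [P, Finsupp.sum, Polynomial.eval_finsetSum, Polynomial.eval_mul,
      Polynomial.eval_C, Polynomial.eval_pow, Polynomial.eval_X, map_smul, smul_eq_mul]
    exact Finset.sum_congr rfl fun j _ => mul_comm _ _
  have hP' : P.derivative = 0 := by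
    refine Polynomial.funext fun τ => ?_
    have := congrArg f (hp' τ)
    rw [map_zero, map_finsuppSum] at this
    rw [Polynomial.eval_zero, this]
    simp only [P, Finsupp.sum, Polynomial.derivative_sum, Polynomial.eval_finsetSum,
      Polynomial.derivative_C_mul_X_pow, Polynomial.eval_mul, Polynomial.eval_C,
      Polynomial.eval_pow, Polynomial.eval_X, map_smul, smul_eq_mul]
    exact Finset.sum_congr rfl fun j _ => by ring
  rw [map_sub, ← hP, ← hP, Polynomial.eq_C_of_derivative_eq_zero hP']
  simp

/-- A polynomial whose derivative takes values in `N` is constant modulo `N`. -/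
theorem HasPolynomialDerivative.sub_mem [CharZero k] (N : Submodule k E) {c c' : k → E}
    (h : HasPolynomialDerivative c c') (hN : ∀ τ, c' τ ∈ N) (σ τ : k) : c σ - c τ ∈ N := by
  have h1 := h.map N.mkQ
  have h2 : (fun τ => N.mkQ (c' τ)) = fun _ => 0 :=
    funext fun τ => (Submodule.Quotient.mk_eq_zero N).2 (hN τ)
  rw [h2] at h1
  have h3 := h1.eq_of_deriv_eq_zero σ τ
  exact (Submodule.Quotient.eq N).1 h3

end PolynomialDerivative

/-! ### Homotopy invariance of correlation densities modulo exact elements -/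

section ListPartitions

variable {X Y : Type*} {E : Type*} [AddCommGroup E]

theorem mark_swapSign_smul (deg : Y → ℤ) (p q : ℤ) (π : List Y) (g : List Y → Y → List Y → E) :
    mark deg p π (fun pre B post => swapSign q (listDeg deg pre) • g pre B post) =
      mark deg (p + q) π g := by
  induction π generalizing g with
  | nil => rfl
  | cons B π ih =>
    simp only [mark, listDeg_nil, swapSign_zero_right, one_smul, listDeg_cons,
      swapSign_add_right, mul_smul, mark_smul, ih, swapSign_add_left]

/-- Signs see only the parity of `p`. With `join_eq_mark`, joining a symbol of degree `-1` thus
becomes marking with an operator of degree `1`. -/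
theorem mark_neg (deg : Y → ℤ) (p : ℤ) (π : List Y) (g : List Y → Y → List Y → E) :
    mark deg (-p) π g = mark deg p π g := by
  induction π generalizing g with
  | nil => rfl
  | cons B π ih => simp only [mark, ih, swapSign, neg_mul, Int.negOnePow_neg]

theorem join_eq_mark (deg : X → ℤ) (x : X) (π : List (List X)) (G : List (List X) → E) :
    join deg x π G =
      mark (listDeg deg) (deg x) π fun pre B post => G (pre ++ (x :: B) :: post) := by
  induction π generalizing G with
  | nil => rfl
  | cons B π ih => rw [join, mark, ih]; rfl

theorem join_of_eq_zero (deg : X → ℤ) (x : X) (π : List (List X)) {G : List (List X) → E}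
    (h : ∀ α, α.length = π.length → G α = 0) : join deg x π G = 0 := by
  rw [join_congr_of_length deg x π (G' := fun _ => (0 : E →+ E) 0) h, ← join_map]
  rfl

theorem adjoin_of_eq_zero (deg : X → ℤ) (x : X) (π : List (List X)) {G : List (List X) → E}
    (h : ∀ α, α ≠ [] → G α = 0) : adjoin deg x π G = 0 := by
  rw [adjoin, h _ (by simp), zero_add]
  cases π with
  | nil => rfl
  | cons B π =>
    refine join_of_eq_zero deg x _ fun α hα => h α ?_
    rintro rfl
    simp at hα

theorem join_of_eq_zero_of_ne_nil (deg : X → ℤ) (x : X) (π : List (List X))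
    {G : List (List X) → E} (h : ∀ α, α ≠ [] → G α = 0) : join deg x π G = 0 := by
  have := adjoin_of_eq_zero deg x π h
  rwa [adjoin, h _ (by simp), zero_add] at this

theorem partSum_eq_zero (deg : X → ℤ) (xs : List X) {G : List (List X) → E}
    (h : ∀ ρ : List (List X), (∀ B ∈ ρ, B ≠ []) →
      (∀ deg' : X → ℤ, listDeg (listDeg deg') ρ = listDeg deg' xs) → G ρ = 0) :
    partSum deg xs [] G = 0 := by
  rw [partSum_congr deg xs (G' := fun _ => (0 : E →+ E) 0) h, ← partSum_map]
  rfl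

theorem listDeg_one (xs : List X) : listDeg (fun _ => 1) xs = xs.length := by
  simp [listDeg]

theorem ne_nil_of_listDeg {xs : List X} (hxs : xs ≠ []) {ρ : List (List X)}
    (hρ : ∀ deg' : X → ℤ, listDeg (listDeg deg') ρ = listDeg deg' xs) : ρ ≠ [] := by
  rintro rfl
  have := hρ fun _ => 1
  rw [listDeg_one, listDeg_nil] at this
  have h := List.length_pos_iff.2 hxs
  omega

/-- Any further block is nonempty and takes at least one symbol away from the marked block. This
makes inductions on the length possible. -/
theorem length_lt_of_mark {xs : List X} {ρ pre post : List (List X)} {B : List X}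
    (hρ : ∀ C ∈ ρ, C ≠ []) (hρ' : ∀ deg' : X → ℤ, listDeg (listDeg deg') ρ = listDeg deg' xs)
    (e : pre ++ B :: post = ρ) (h : pre ≠ [] ∨ post ≠ []) : B.length < xs.length := by
  have hlen : ∀ l : List (List X), (∀ C ∈ l, C ≠ []) → l ≠ [] →
      0 < listDeg (listDeg fun _ => 1) l := by
    intro l hl hne
    induction l with
    | nil => exact absurd rfl hne
    | cons C l ih =>
      have hC := List.length_pos_iff.2 (hl C (by simp))
      rw [listDeg_cons, listDeg_one]
      by_cases hl0 : l = []
      · subst hl0; simpa using hC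
      · have := ih (fun D hD => hl D (by simp [hD])) hl0
        omega
  have hnonneg : ∀ l : List (List X), (∀ C ∈ l, C ≠ []) →
      0 ≤ listDeg (listDeg fun _ => 1) l := by
    intro l hl
    by_cases hl0 : l = []
    · subst hl0; simp
    · exact (hlen l hl hl0).le
  have h1 := hρ' fun _ => 1
  rw [← e, listDeg_append, listDeg_cons, listDeg_one, listDeg_one] at h1
  subst e
  have hpre : ∀ C ∈ pre, C ≠ [] := fun C hC => hρ C (by simp [hC])
  have hpost : ∀ C ∈ post, C ≠ [] := fun C hC => hρ C (by simp [hC])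
  rcases h with h | h
  · have := hlen pre hpre h
    have := hnonneg post hpost
    omega
  · have := hlen post hpost h
    have := hnonneg pre hpre
    omega

/-- If only a single block may be marked, the sum has one term. -/
theorem partSum_mark_oneBlock (deg : X → ℤ) (p : ℤ) {xs : List X} (hxs : xs ≠ [])
    (g : List (List X) → List X → List (List X) → E)
    (hpre : ∀ pre B post, pre ≠ [] → g pre B post = 0)
    (hpost : ∀ pre B post, post ≠ [] → g pre B post = 0) :
    partSum deg xs [] (fun ρ => mark (listDeg deg) p ρ g) = g [] xs [] := by
  induction xs generalizing g with
  | nil => exact absurd rfl hxs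
  | cons x xs ih =>
    simp only [partSum, adjoin_mark, partSum_add]
    have h1 : ∀ pre B post, adjoin deg x pre (fun α => g α B post) = 0 := fun pre B post =>
      adjoin_of_eq_zero deg x pre fun α hα => hpre α B post hα
    have h2 : ∀ pre B post, join deg x post (fun β => g pre B β) = 0 := fun pre B post =>
      join_of_eq_zero_of_ne_nil deg x post fun β hβ => hpost pre B β hβ
    simp only [h1, h2, smul_zero, zero_add, add_zero]
    by_cases hx : xs = []
    · subst hx
      simp [partSum, mark]
    · rw [partSum_eq_zero deg xs fun ρ _ hρ => hpost _ _ _ (ne_nil_of_listDeg hx hρ), zero_add,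
        ih hx]
      · simp
      · intro pre B post h
        rw [hpre _ _ _ h, smul_zero]
      · intro pre B post h
        rw [hpost _ _ _ h, smul_zero]

/-! #### Renaming of symbols -/

theorem listDeg_map (f : X → Y) (deg' : Y → ℤ) (B : List X) :
    listDeg deg' (B.map f) = listDeg (fun x => deg' (f x)) B := by
  simp [listDeg, Function.comp_def]

theorem mark_map_symbols (f : X → Y) (deg' : Y → ℤ) (p : ℤ) (π : List X)
    (g : List Y → Y → List Y → E) :
    mark deg' p (π.map f) g = mark (fun x => deg' (f x)) p π fun pre B post =>
      g (pre.map f) (f B) (post.map f) := by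
  induction π generalizing g with
  | nil => rfl
  | cons B π ih => simp only [List.map_cons, mark, ih]; rfl

theorem join_map_symbols (f : X → Y) (deg' : Y → ℤ) (x : X) (π : List (List X))
    (G : List (List Y) → E) :
    join deg' (f x) (π.map (List.map f)) G =
      join (fun x => deg' (f x)) x π fun ρ => G (ρ.map (List.map f)) := by
  induction π generalizing G with
  | nil => rfl
  | cons B π ih => simp only [List.map_cons, join, ih, listDeg_map]

theorem partSum_map_symbols (f : X → Y) (deg' : Y → ℤ) (xs : List X) (π : List (List X))
    (G : List (List Y) → E) :
    partSum deg' (xs.map f) (π.map (List.map f)) G =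
      partSum (fun x => deg' (f x)) xs π fun ρ => G (ρ.map (List.map f)) := by
  induction xs generalizing G with
  | nil => rfl
  | cons x xs ih =>
    simp only [List.map_cons, partSum, ih, adjoin, join_map_symbols, List.map_nil]

/-! ### An additional symbol of degree `-1`. -/

/-- The degrees of the symbols in `X`, and of one further symbol of degree `-1`. -/
def optionDeg (deg : X → ℤ) : Option X → ℤ
  | none => -1
  | some x => deg x

open Classical in
/-- The function on blocks of symbols in `Option X` that is `F` on blocks of symbols in `X`, is `N`
on such blocks preceded by the additional symbol, and vanishes on all others. -/
def extendBlock (F N : List X → E) : List (Option X) → E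
  | [] => F []
  | none :: B => if none ∈ B then 0 else N B.reduceOption
  | some x :: B => if none ∈ B then 0 else F (x :: B.reduceOption)

theorem reduceOption_map_some (B : List X) : (B.map some).reduceOption = B := by
  simp [List.reduceOption]

theorem extendBlock_map_some (F N : List X → E) (B : List X) :
    extendBlock F N (B.map some) = F B := by
  cases B with
  | nil => rfl
  | cons x B => simp [extendBlock, reduceOption_map_some]

theorem extendBlock_none_cons (F N : List X → E) (B : List X) :
    extendBlock F N (none :: B.map some) = N B := by
  simp [extendBlock, reduceOption_map_some]

theorem listDeg_optionDeg (deg : X → ℤ) {B : List (Option X)} (hB : none ∉ B) :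
    listDeg (optionDeg deg) B = listDeg deg B.reduceOption := by
  induction B with
  | nil => rfl
  | cons b B ih =>
    cases b with
    | none => simp at hB
    | some x =>
      have := ih fun h => hB (by simp [h])
      simp [this, optionDeg]

end ListPartitions

/-! ### Closedness of the densities and their change along a flow. -/

section Homotopy

variable {V : PointedGradedSpace.{u, v} k} {W : PointedGradedSpace.{u, w} k}
  {U : PointedGradedSpace.{u, w'} k} {X : Type*} {deg : X → ℤ} {val : X → V}

theorem extendBlock_mem {F N : List X → W} (hF : ∀ B, F B ∈ W.deg (listDeg deg B))
    (hN : ∀ B, N B ∈ W.deg (listDeg deg B - 1)) (B : List (Option X)) :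
    extendBlock F N B ∈ W.deg (listDeg (optionDeg deg) B) := by
  match B with
  | [] => exact hF []
  | none :: B =>
    rw [extendBlock]
    split_ifs with h
    · exact zero_mem _
    · rw [listDeg_cons, listDeg_optionDeg deg h, optionDeg, neg_add_eq_sub]
      exact hN _
  | some x :: B =>
    rw [extendBlock]
    split_ifs with h
    · exact zero_mem _
    · rw [listDeg_cons, listDeg_optionDeg deg h, optionDeg, ← listDeg_cons]
      exact hF _

/-- Suppose that the sums `∑ ε(π) ℓ (F (x_{B₁}), …)` vanish for all lists shorter than `xs`. Then
the insertion into `M (F (x_{B₁}), …)` of the insertions of `N` into `ℓ (F (x_{B₁}), …)` is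
exact. -/
theorem HomotopyProbabilityAlgebra.mark_mem_range (A : HomotopyProbabilityAlgebra W)
    {F N : List X → W} (hF : ∀ B, F B ∈ W.deg (listDeg deg B))
    (hN : ∀ B, N B ∈ W.deg (listDeg deg B - 1)) (hN0 : N [] = 0) (xs : List X)
    (hE : ∀ B : List X, B ≠ [] → B.length < xs.length →
      partSum deg B [] (fun σ => Family.onList A.descendant (σ.map F)) = 0) :
    (partSum deg xs [] fun ρ => mark (listDeg deg) 0 ρ fun pre B post =>
      Family.onList A.M (pre.map F ++
        (partSum deg B [] fun σ => mark (listDeg deg) 1 σ fun pre' B' post' =>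
          Family.onList A.descendant (pre'.map F ++ N B' :: post'.map F)) :: post.map F)) ∈
      LinearMap.range A.K := by
  -- The primitive is `∑ ± M (F, …, N, …, F)`, written as an ordinary sum over the partitions of
  -- `none :: xs`: the block containing `none` takes the value of `N`, and `none` alone takes `N []
  -- = 0`. Hence `K_partSum` applies and produces the signs.
  refine ⟨partSum (optionDeg deg) (none :: xs.map some) [] fun π =>
    Family.onList A.M (π.map (extendBlock F N)), ?_⟩
  have hφF : ∀ π : List (List X), (π.map (List.map some)).map (extendBlock F N) = π.map F := by
    intro π
    rw [List.map_map]
    exact List.map_congr_left fun B _ => extendBlock_map_some F N B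
  have hφ0 : extendBlock F N [none] = 0 := (extendBlock_none_cons F N []).trans hN0
  have hsum : ∀ (ys : List X) (G : List (List (Option X)) → W),
      partSum (optionDeg deg) (ys.map some) [] G =
        partSum deg ys [] fun ρ => G (ρ.map (List.map some)) :=
    fun ys G => partSum_map_symbols some (optionDeg deg) ys [] G
  have hmark : ∀ (p : ℤ) (ρ : List (List X))
      (g : List (List (Option X)) → List (Option X) → List (List (Option X)) → W),
      mark (listDeg (optionDeg deg)) p (ρ.map (List.map some)) g =
        mark (listDeg deg) p ρ fun pre B post =>
          g (pre.map (List.map some)) (B.map some) (post.map (List.map some)) := by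
    intro p ρ g
    rw [mark_map_symbols]
    simp only [listDeg_map]
    rfl
  have hdeg : ∀ ρ : List (List X), listDeg (listDeg (optionDeg deg)) (ρ.map (List.map some)) =
      listDeg (listDeg deg) ρ := by
    intro ρ
    rw [listDeg_map]
    simp only [listDeg_map]
    rfl
  have hEB : ∀ B : List X, partSum (optionDeg deg) (B.map some) [] (fun σ =>
      Family.onList A.descendant (σ.map (extendBlock F N))) =
      partSum deg B [] fun σ => Family.onList A.descendant (σ.map F) := by
    intro B
    rw [hsum]
    simp only [hφF]
  have hEN : ∀ B : List X, partSum (optionDeg deg) (none :: B.map some) [] (fun σ =>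
      Family.onList A.descendant (σ.map (extendBlock F N))) =
      partSum deg B [] fun σ => mark (listDeg deg) 1 σ fun pre' B' post' =>
          Family.onList A.descendant (pre'.map F ++ N B' :: post'.map F) := by
    intro B
    rw [partSum, hsum]
    refine partSum_congr deg B fun σ _ _ => ?_
    rw [adjoin, List.map_cons, hφ0, Family.onList_eq_zero _ (by simp), zero_add, join_eq_mark,
      hmark, optionDeg, mark_neg]
    simp only [List.map_append, List.map_cons, hφF, extendBlock_none_cons]
  rw [A.K_partSum (optionDeg deg) _ (extendBlock_mem hF hN) (by simp), partSum, hsum]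
  refine partSum_congr deg xs fun ρ hρ hρ' => ?_
  rw [adjoin_mark, List.map_nil, List.nil_append]
  have h0 : partSum (optionDeg deg) [none] [] (fun σ =>
      Family.onList A.descendant (σ.map (extendBlock F N))) = 0 := by
    simp only [partSum, adjoin, join, add_zero, List.map_cons, hφ0]
    exact Family.onList_eq_zero _ (by simp)
  -- If `none` lands in the marked block, the operator `K` of degree `1` and `none` of degree `-1`
  -- both pass `pre`. Their signs cancel, leaving a marking of degree `0`.
  rw [h0, Family.onList_eq_zero _ (by simp), zero_add, hmark,
    show (0 : ℤ) = 1 + -1 by norm_num, ← mark_swapSign_smul]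
  refine mark_congr _ _ _ fun pre B post e => ?_
  have hB : B ≠ [] := hρ B (by simp [← e])
  have hzero : (pre ≠ [] ∨ post ≠ []) → partSum (optionDeg deg) (B.map some) [] (fun σ =>
      Family.onList A.descendant (σ.map (extendBlock F N))) = 0 := by
    intro h
    rw [hEB]
    exact hE B hB (length_lt_of_mark hρ hρ' e h)
  -- If `none` lands outside the marked block, the term contains the sum of `hE` for `B`, which
  -- vanishes when `B` is shorter than `xs`. If `B` is everything, `none` can only form a block of
  -- its own, and the term contains `N [] = 0`.
  have h1 : adjoin (optionDeg deg) none (pre.map (List.map some)) (fun α =>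
      Family.onList A.M (α.map (extendBlock F N) ++
        partSum (optionDeg deg) (B.map some) [] (fun σ =>
          Family.onList A.descendant (σ.map (extendBlock F N))) ::
        (post.map (List.map some)).map (extendBlock F N))) = 0 := by
    by_cases h : pre ≠ [] ∨ post ≠ []
    · refine adjoin_of_eq_zero _ _ _ fun α _ => ?_
      rw [hzero h]
      exact Family.onList_eq_zero _ (by simp)
    · obtain ⟨rfl, rfl⟩ : pre = [] ∧ post = [] := by simpa using h
      simp only [adjoin, join, add_zero, List.map_nil, List.map_cons, hφ0]
      exact Family.onList_eq_zero _ (by simp)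
  have h2 : join (optionDeg deg) none (post.map (List.map some)) (fun β =>
      Family.onList A.M ((pre.map (List.map some)).map (extendBlock F N) ++
        partSum (optionDeg deg) (B.map some) [] (fun σ =>
          Family.onList A.descendant (σ.map (extendBlock F N))) ::
        β.map (extendBlock F N))) = 0 := by
    by_cases h : post = []
    · subst h; rfl
    · refine join_of_eq_zero _ _ _ fun β _ => ?_
      rw [hzero (Or.inr h)]
      exact Family.onList_eq_zero _ (by simp)
  rw [h1, h2, hEN, hdeg, hφF, hφF, smul_zero, smul_zero, zero_add, add_zero]
  rfl

/-- If the sums `∑ ε(π) ℓ (F (x_{B₁}), …)` vanish for all lists shorter than `xs`, then the one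
for `xs` is the differential of `∑ ε(π) M (F (x_{B₁}), …)`. -/
theorem HomotopyProbabilityAlgebra.K_partSum_eq (A : HomotopyProbabilityAlgebra W)
    {F : List X → W} (hF : ∀ B, F B ∈ W.deg (listDeg deg B)) {xs : List X} (hxs : xs ≠ [])
    (hE : ∀ B : List X, B ≠ [] → B.length < xs.length →
      partSum deg B [] (fun σ => Family.onList A.descendant (σ.map F)) = 0) :
    A.K (partSum deg xs [] fun π => Family.onList A.M (π.map F)) =
      partSum deg xs [] fun σ => Family.onList A.descendant (σ.map F) := by
  classical
  rw [A.K_partSum deg F hF hxs]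
  have h : ∀ a, Family.onList A.M [a] = a := by
    intro a
    rw [← Family.linearPart_apply, A.M_one]
    rfl
  -- Terms with a proper marked block vanish by `hE`; the one with `xs` as marked block survives,
  -- where `M₁` is the identity.
  have key := partSum_mark_oneBlock deg 1 hxs (fun pre B post =>
    if pre = [] ∧ post = [] then
      partSum deg B [] (fun σ => Family.onList A.descendant (σ.map F)) else 0)
    (fun _ _ _ h => if_neg fun h' => h h'.1) (fun _ _ _ h => if_neg fun h' => h h'.2)
  rw [if_pos ⟨rfl, rfl⟩] at key
  rw [← key]
  refine partSum_congr deg xs fun ρ hρ hρ' => mark_congr _ _ _ fun pre B post e => ?_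
  split_ifs with h'
  · rw [h'.1, h'.2]
    exact h _
  · rw [hE B (hρ B (by simp [← e])) (length_lt_of_mark hρ hρ' e (by tauto))]
    exact Family.onList_eq_zero _ (by simp)

/-- The derivative of the correlation densities along a polynomial path of families. -/
theorem HasPolynomialDerivative.comp (hv : ∀ a, val a ∈ V.deg (deg a)) (g : Family W U)
    {Φ Φ' : k → Family V W} (h : ∀ n : ℕ, 1 ≤ n → ∀ x : Fin n → V,
      HasPolynomialDerivative (fun τ => Φ τ n x) (fun τ => Φ' τ n x)) (xs : List X) :
    HasPolynomialDerivative (fun τ => (comp g (Φ τ)).onList (xs.map val)) (fun τ =>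
      partSum deg xs [] fun π => mark (listDeg deg) 0 π fun pre B post =>
        g.onList (pre.map (fun B => (Φ τ).onList (B.map val)) ++ (Φ' τ).onList (B.map val) ::
          post.map (fun B => (Φ τ).onList (B.map val)))) := by
  obtain ⟨n, x, rfl⟩ : ∃ n, ∃ x : Fin n → X, List.ofFn x = xs := ⟨_, exists_ofFn_eq xs rfl⟩
  have h1 : ∀ τ, (HomotopyProbability.comp g (Φ τ)).onList ((List.ofFn x).map val) =
      ∑ π : OrderedFinpartition n, partitionSign (fun i => deg (x i)) π •
        g π.length (fun j => Φ τ (π.partSize j) (fun r => val (x (π.emb j r)))) := by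
    intro τ
    rw [Family.onList_map_ofFn]
    exact comp_apply g (Φ τ) _ (fun i => deg (x i)) _ fun i => hv _
  simp only [h1, partSum_ofFn]
  refine HasPolynomialDerivative.sum _ fun π _ => HasPolynomialDerivative.units_smul ?_ _
  simp only [← sum_update_eq_mark deg 0 g, swapSign_zero_left, ite_self, Finset.prod_const_one,
    one_smul, Family.onList_map_ofFn]
  exact HasPolynomialDerivative.multilinear _ fun i => h _ (π.partSize_pos i) _

theorem insertion_eq_zero (g : Family W U) (f : Family V W) {η : Family V W}
    (hη : ∀ n : ℕ, 1 ≤ n → η n = 0) (n : ℕ) : insertion g f η n = 0 := by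
  refine multilinearMap_ext_homogeneous fun d x hx => ?_
  rw [insertion_apply g f η n d x hx]
  refine Finset.sum_eq_zero fun π _ => Finset.sum_eq_zero fun i _ => ?_
  rw [hη _ (π.partSize_pos i), (g π.length).map_coord_zero i (by simp), smul_zero]

theorem insertion_zero (g : Family W U) (f : Family V W) (n : ℕ) :
    insertion g f (0 : Family V W) n = 0 := insertion_eq_zero g f (fun _ _ => rfl) n

theorem IsSymmetricOfDegree.onBlock_mem_sub_one {f : Family V W}
    (hf : IsSymmetricOfDegree (-1) f) (hv : ∀ a, val a ∈ V.deg (deg a)) (B : List X) :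
    f.onBlock val B ∈ W.deg (listDeg deg B - 1) := by
  by_cases hB : B = []
  · subst hB; simp
  · rw [f.onBlock_of_ne_nil val hB]
    exact hf.onList_mem hv hB

theorem comp_congr_right (g : Family W U) {f f' : Family V W}
    (h : ∀ n : ℕ, 1 ≤ n → f n = f' n) (n : ℕ) : comp g f n = comp g f' n := by
  refine multilinearMap_ext_homogeneous fun d x hx => ?_
  rw [comp_apply g f n d x hx, comp_apply g f' n d x hx]
  refine Finset.sum_congr rfl fun π _ => ?_
  congr 2
  funext j
  rw [h _ (π.partSize_pos j)]

/-- The correlation densities of a unital morphism from `(V, 0)` are closed. -/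
theorem K_correlationDensity (A : HomotopyProbabilityAlgebra W)
    (φ : UnitalMorphism (0 : Family V V) A.descendant) (n : ℕ) (hn : 1 ≤ n) :
    A.K.compMultilinearMap (correlationDensity A φ.toFamily n) = 0 := by
  refine multilinearMap_ext_homogeneous fun d x hx => ?_
  obtain ⟨y, rfl, rfl⟩ := exists_homogeneousElement d x hx
  have hv := HomogeneousElement.val_mem (V := V)
  have hE : ∀ B : List (HomogeneousElement V), B ≠ [] → partSum Sigma.fst B [] (fun σ =>
      Family.onList A.descendant (σ.map (φ.toFamily.onBlock HomogeneousElement.val))) = 0 := by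
    intro B hB
    rw [← onList_comp_eq_onBlock hv, Family.onList, φ.relation _ (by
      rw [List.length_map]; exact List.length_pos_iff.2 hB), insertion_zero]
    rfl
  have hy : List.ofFn y ≠ [] := by
    intro h
    have := congrArg List.length h
    simp at this
    omega
  have := A.K_partSum_eq (φ.symmetric.onBlock_mem hv) hy fun B hB _ => hE B hB
  rw [hE _ hy, ← onList_comp_eq_onBlock hv, Family.onList_map_ofFn] at this
  exact this

/-- The correlation densities of homotopic morphisms differ by exact elements. -/
theorem Homotopic.correlationDensity_sub_mem [CharZero k] {A : HomotopyProbabilityAlgebra W}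
    {φ ψ : UnitalMorphism (0 : Family V V) A.descendant} (h : Homotopic φ ψ) (n : ℕ)
    (d : Fin n → ℤ) (x : Fin n → V) (hx : ∀ i, x i ∈ V.deg (d i)) :
    correlationDensity A ψ.toFamily n x - correlationDensity A φ.toFamily n x ∈
      LinearMap.range A.K := by
  obtain ⟨η, Φ, hη, -, hΦ, h0, h1, hflow⟩ := h
  have hv := HomogeneousElement.val_mem (V := V)
  let P : k → List (HomogeneousElement V) → W := fun τ xs =>
    (comp A.M (Φ τ)).onList (xs.map HomogeneousElement.val)
  let E : k → List (HomogeneousElement V) → W := fun τ xs => partSum Sigma.fst xs [] fun σ =>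
    Family.onList A.descendant (σ.map ((Φ τ).onBlock HomogeneousElement.val))
  have hP : ∀ τ xs, P τ xs = partSum Sigma.fst xs [] fun σ =>
      Family.onList A.M (σ.map ((Φ τ).onBlock HomogeneousElement.val)) :=
    fun τ xs => onList_comp_eq_onBlock hv _ _ _
  have hflow' : ∀ n : ℕ, 1 ≤ n → ∀ x : Fin n → V, HasPolynomialDerivative
      (fun τ => Φ τ n x) (fun τ => insertion A.descendant (Φ τ) (η τ) n x) := by
    intro n hn x
    have := hflow n hn x
    simpa only [insertion_zero, zero_apply, add_zero] using this
  -- If the morphism relations hold at all times for shorter lists, the derivative of `P` is exact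
  -- by `mark_mem_range`, so `P` is constant in time modulo exact elements.
  have hexact : ∀ xs : List (HomogeneousElement V),
      (∀ B : List (HomogeneousElement V), B ≠ [] → B.length < xs.length → ∀ τ, E τ B = 0) →
      ∀ σ τ, P σ xs - P τ xs ∈ LinearMap.range A.K := by
    intro xs hxs
    refine (HasPolynomialDerivative.comp hv A.M hflow' xs).sub_mem _ fun τ => ?_
    convert A.mark_mem_range ((hΦ τ).onBlock_mem hv) ((hη τ).symmetric.onBlock_mem_sub_one hv)
      ((η τ).onBlock_nil _) xs (fun B hB hB' => hxs B hB hB' τ) using 1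
    refine partSum_congr _ _ fun ρ hρ _ => mark_congr _ _ _ fun pre B post e => ?_
    have hB : B ≠ [] := hρ B (by simp [← e])
    have hmap : ∀ l : List (List (HomogeneousElement V)), (∀ C ∈ l, C ≠ []) →
        (l.map fun B => (Φ τ).onList (B.map HomogeneousElement.val)) =
          l.map ((Φ τ).onBlock HomogeneousElement.val) := fun l hl =>
      List.map_congr_left fun C hC => ((Φ τ).onBlock_of_ne_nil _ (hl C hC)).symm
    rw [hmap pre fun C hC => hρ C (by simp [← e, hC]),
      hmap post fun C hC => hρ C (by simp [← e, hC]), onList_insertion _ _ hv]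
    congr 3
    refine partSum_congr _ _ fun σ hσ _ => mark_congr _ _ _ fun pre' B' post' e' => ?_
    rw [hmap pre' fun C hC => hσ C (by simp [← e', hC]),
      hmap post' fun C hC => hσ C (by simp [← e', hC]),
      (η τ).onBlock_of_ne_nil _ (hσ B' (by simp [← e']))]
  -- The intermediate `Φ τ` are not assumed to be morphisms. By induction on the length, `E τ = K (P
  -- τ)` and `P τ - P 0` is exact, so `K² = 0` gives `E τ = E 0`, which vanishes since `Φ 0` is `φ`.
  have hE : ∀ m : ℕ, ∀ xs : List (HomogeneousElement V), xs ≠ [] → xs.length = m →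
      ∀ τ, E τ xs = 0 := by
    intro m
    induction m using Nat.strong_induction_on with
    | _ m ih =>
      intro xs hxs hm τ
      have hsmall : ∀ B : List (HomogeneousElement V), B ≠ [] → B.length < xs.length →
          ∀ τ, E τ B = 0 := fun B hB hB' => ih _ (hm ▸ hB') B hB rfl
      have hK : ∀ τ, A.K (P τ xs) = E τ xs := by
        intro τ
        rw [hP]
        exact A.K_partSum_eq ((hΦ τ).onBlock_mem hv) hxs fun B hB hB' => hsmall B hB hB' τ
      have hE0 : E 0 xs = 0 := by
        have e1 : E 0 xs = (comp A.descendant (Φ 0)).onList (xs.map HomogeneousElement.val) :=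
          (onList_comp_eq_onBlock hv _ _ _).symm
        rw [e1, Family.onList, comp_congr_right _ h0, φ.relation _ (by
          rw [List.length_map]; exact List.length_pos_iff.2 hxs), insertion_zero]
        rfl
      obtain ⟨z, hz⟩ := hexact xs hsmall τ 0
      have hz' := congrArg A.K hz
      rw [map_sub, hK, hK, hE0, sub_zero] at hz'
      rw [← hz']
      exact LinearMap.congr_fun A.K_comp_K z
  obtain ⟨y, rfl, rfl⟩ := exists_homogeneousElement d x hx
  have := hexact (List.ofFn y) (fun B hB _ => hE _ B hB rfl) 1 0
  simp only [P, Family.onList_map_ofFn] at this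
  rwa [comp_congr_right _ h0, comp_congr_right _ h1] at this

end Homotopy

/-! ### Homotopy inverses -/

section HomotopyInverses

/-- Over a field, choose `s` with `K s = id` on the image of `K`, and `g` with `g f = id` and `g K =
0`. Then `p = id - s K` projects onto the closed elements, and `h = g p`, `β = -s (id - f g) p`
work: `p x - f (g (p x))` is exact, so `K β = -p + f g p`, while `β K = -s K`. Moreover `p f = f`
and `g f = id` give `β f = 0`, from which `β(1) = 0` will follow. -/
theorem exists_ungraded_homotopyInverse {S C : Type*} [AddCommGroup S] [Module k S]
    [AddCommGroup C] [Module k C] (K : C →ₗ[k] C) (f : S →ₗ[k] C) (hK : K ∘ₗ K = 0)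
    (hf : K ∘ₗ f = 0) (hinj : ∀ a, f a ∈ LinearMap.range K → a = 0)
    (hsurj : ∀ x, K x = 0 → ∃ a, x - f a ∈ LinearMap.range K) :
    ∃ (h : C →ₗ[k] S) (β : C →ₗ[k] C), h ∘ₗ K = 0 ∧ h ∘ₗ f = LinearMap.id ∧
      f ∘ₗ h = LinearMap.id + K ∘ₗ β + β ∘ₗ K ∧ β ∘ₗ f = 0 := by
  have hK' : ∀ x, K (K x) = 0 := LinearMap.congr_fun hK
  have hf' : ∀ a, K (f a) = 0 := LinearMap.congr_fun hf
  obtain ⟨r, hr⟩ := K.rangeRestrict.exists_rightInverse_of_surjective K.range_rangeRestrict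
  obtain ⟨q, hq⟩ := (LinearMap.range K).subtype.exists_leftInverse_of_injective
    (Submodule.ker_subtype _)
  obtain ⟨ρ, hρ⟩ := ((LinearMap.range K).mkQ ∘ₗ f).exists_leftInverse_of_injective
    (LinearMap.ker_eq_bot'.2 fun a ha => hinj a (by simpa using ha))
  have hs : ∀ y ∈ LinearMap.range K, K (r (q y)) = y := by
    intro y hy
    have h1 : q y = ⟨y, hy⟩ := LinearMap.congr_fun hq ⟨y, hy⟩
    have h2 := congrArg Subtype.val (LinearMap.congr_fun hr ⟨y, hy⟩)
    rw [h1]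
    exact h2
  have hgf : ∀ a, ρ ((LinearMap.range K).mkQ (f a)) = a := LinearMap.congr_fun hρ
  have hgK : ∀ y ∈ LinearMap.range K, ρ ((LinearMap.range K).mkQ y) = 0 := by
    intro y hy
    rw [Submodule.mkQ_apply, (Submodule.Quotient.mk_eq_zero _).2 hy, map_zero]
  let s : C →ₗ[k] C := r ∘ₗ q
  let g : C →ₗ[k] S := ρ ∘ₗ (LinearMap.range K).mkQ
  let p : C →ₗ[k] C := LinearMap.id - s ∘ₗ K
  have hs' : ∀ y ∈ LinearMap.range K, K (s y) = y := hs
  have hgf' : ∀ a, g (f a) = a := hgf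
  have hgK' : ∀ y ∈ LinearMap.range K, g y = 0 := hgK
  have hp : ∀ x, p x = x - s (K x) := fun _ => rfl
  refine ⟨g ∘ₗ p, -(s ∘ₗ (LinearMap.id - f ∘ₗ g) ∘ₗ p), ?_, ?_, ?_, ?_⟩
  · ext x
    simp [hp, hK', hgK' (K x) ⟨x, rfl⟩]
  · ext a
    simp [hp, hf', hgf']
  · ext x
    obtain ⟨a, ha⟩ := hsurj (p x) (by rw [hp, map_sub, hs' _ ⟨x, rfl⟩, sub_self])
    have h1 : g (p x) = a := by
      have := hgK' _ ha
      rwa [map_sub, hgf', sub_eq_zero] at this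
    have h2 := hs' _ ha
    simp only [LinearMap.comp_apply, LinearMap.add_apply, LinearMap.neg_apply,
      LinearMap.sub_apply, LinearMap.id_apply, h1, map_neg, h2]
    rw [hp (K x), hK', map_zero, sub_zero, hgK' (K x) ⟨x, rfl⟩, map_zero, sub_zero, hp]
    abel
  · ext a
    simp [hp, hf', hgf']

variable {V : PointedGradedSpace.{u, v} k} {W : PointedGradedSpace.{u, w} k}
  {U : PointedGradedSpace.{u, w'} k}

theorem linearMap_ext_homogeneous {E : Type*} [AddCommGroup E] [Module k E] {f g : V →ₗ[k] E}
    (h : ∀ (j : ℤ) (x : V), x ∈ V.deg j → f x = g x) : f = g := by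
  ext x
  induction x using DirectSum.Decomposition.inductionOn V.deg with
  | zero => simp
  | homogeneous x => exact h _ _ x.2
  | add x y hx hy => rw [map_add, map_add, hx, hy]

/-- The component of degree `p` of a linear map. -/
def homogeneousPart (p : ℤ) (T : V →ₗ[k] W) : V →ₗ[k] W :=
  DirectSum.toModule k ℤ W (fun j => (W.deg (j + p)).subtype ∘ₗ
    DirectSum.component k ℤ (fun i => W.deg i) (j + p) ∘ₗ
    (DirectSum.decomposeLinearEquiv W.deg).toLinearMap ∘ₗ T ∘ₗ (V.deg j).subtype) ∘ₗ
    (DirectSum.decomposeLinearEquiv V.deg).toLinearMap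

theorem homogeneousPart_apply (p : ℤ) (T : V →ₗ[k] W) {j : ℤ} {x : V} (hx : x ∈ V.deg j) :
    homogeneousPart p T x = DirectSum.decompose W.deg (T x) (j + p) := by
  have h : DirectSum.decomposeLinearEquiv V.deg x =
      DirectSum.lof k ℤ (fun j => V.deg j) j ⟨x, hx⟩ :=
    DirectSum.decomposeLinearEquiv_apply_coe V.deg j ⟨x, hx⟩
  simp only [homogeneousPart, LinearMap.comp_apply, LinearEquiv.coe_coe]
  rw [h, DirectSum.toModule_lof]
  rfl

theorem hasDegree_homogeneousPart (p : ℤ) (T : V →ₗ[k] W) : HasDegree p (homogeneousPart p T) := by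
  intro j x hx
  rw [homogeneousPart_apply p T hx]
  exact SetLike.coe_mem _

theorem HasDegree.decompose {p : ℤ} {f : V →ₗ[k] W} (hf : HasDegree p f) (x : V) (i : ℤ) :
    (DirectSum.decompose W.deg (f x) (i + p) : W) = f (DirectSum.decompose V.deg x i) := by
  induction x using DirectSum.Decomposition.inductionOn V.deg with
  | zero => simp
  | @homogeneous j x =>
    by_cases h : j = i
    · subst h
      rw [DirectSum.decompose_of_mem_same _ (hf _ _ x.2), DirectSum.decompose_of_mem_same _ x.2]
    · rw [DirectSum.decompose_of_mem_ne _ (hf _ _ x.2) (by omega),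
        DirectSum.decompose_of_mem_ne _ x.2 h, map_zero]
  | add x y hx hy => simp [DirectSum.decompose_add, hx, hy]

/-- A quasi-isomorphism from a complex with zero differential has a homotopy inverse. -/
theorem exists_homotopyInverse (K : W →ₗ[k] W) (f : V →ₗ[k] W) (hKd : HasDegree 1 K)
    (hfd : HasDegree 0 f) (hK : K ∘ₗ K = 0) (hf : K ∘ₗ f = 0)
    (hinj : ∀ a, f a ∈ LinearMap.range K → a = 0)
    (hsurj : ∀ x, K x = 0 → ∃ a, x - f a ∈ LinearMap.range K) :
    ∃ D : HomotopyInverse K f, ∀ a ∈ V.deg 0, D.β (f a) = 0 := by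
  obtain ⟨h, β, h1, h2, h3, h4⟩ := exists_ungraded_homotopyInverse K f hK hf hinj hsurj
  -- The splittings ignore the grading. Since `K` and `f` are homogeneous, the relations persist for
  -- the parts of `h` and `β` of degrees `0` and `-1`.
  refine ⟨⟨homogeneousPart 0 h, homogeneousPart (-1) β, hasDegree_homogeneousPart _ _,
    hasDegree_homogeneousPart _ _, ?_, ?_, ?_⟩, ?_⟩
  · refine linearMap_ext_homogeneous fun j x hx => ?_
    rw [LinearMap.comp_apply, homogeneousPart_apply 0 h (hKd j x hx), ← LinearMap.comp_apply, h1]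
    simp
  · refine linearMap_ext_homogeneous fun j x hx => ?_
    rw [LinearMap.comp_apply, homogeneousPart_apply 0 h (hfd j x hx), ← LinearMap.comp_apply, h2,
      add_zero, add_zero]
    exact DirectSum.decompose_of_mem_same _ hx
  · refine linearMap_ext_homogeneous fun j x hx => ?_
    have h3' := LinearMap.congr_fun h3 x
    simp only [LinearMap.comp_apply, LinearMap.add_apply, LinearMap.id_apply] at h3' ⊢
    rw [homogeneousPart_apply 0 h hx, homogeneousPart_apply (-1) β hx,
      homogeneousPart_apply (-1) β (hKd j x hx), ← hfd.decompose, ← hKd.decompose, h3']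
    rw [show j + 0 + 0 = j by ring, show j + -1 + 1 = j by ring, show j + 1 + -1 = j by ring]
    simp only [DirectSum.decompose_add, DirectSum.add_apply, Submodule.coe_add]
    rw [DirectSum.decompose_of_mem_same _ hx]
  · intro a ha
    change homogeneousPart (-1) β (f a) = 0
    rw [homogeneousPart_apply (-1) β (hfd _ _ ha), ← LinearMap.comp_apply, h4]
    simp

/-- A homotopy inverse on closed elements only depends on the map up to exact elements. -/
theorem HomotopyInverse.h_eq {K : W →ₗ[k] W} {f f' : V →ₗ[k] W} (D : HomotopyInverse K f)
    (D' : HomotopyInverse K f') (hff' : ∀ a, f' a - f a ∈ LinearMap.range K) {x : W}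
    (hx : K x = 0) : D.h x = D'.h x := by
  have h1 := LinearMap.congr_fun D.f_comp_h x
  have h2 := LinearMap.congr_fun D'.f_comp_h x
  simp only [LinearMap.comp_apply, LinearMap.add_apply, LinearMap.id_apply, hx, map_zero,
    add_zero] at h1 h2
  obtain ⟨y, hy⟩ := hff' (D'.h x)
  -- On the closed element `x`, both `f (D.h x)` and `f' (D'.h x)` equal `x` modulo exact elements,
  -- so `f` of the difference is exact; applying `D.h`, a left inverse of `f` that kills exact
  -- elements, shows that the difference is zero.
  have h3 : f (D.h x - D'.h x) = K (D.β x - D'.β x + y) := by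
    rw [map_sub, map_add, map_sub, hy, h1, sub_eq_sub_iff_add_eq_add.2 rfl |>.symm]
    rw [h2]
    abel
  have h4 := LinearMap.congr_fun D.h_comp_f (D.h x - D'.h x)
  rw [LinearMap.comp_apply, h3, ← LinearMap.comp_apply, D.h_comp_K] at h4
  exact sub_eq_zero.1 h4.symm

end HomotopyInverses

/-! ### Quasi-isomorphisms from a complex with zero differential -/

section QuasiIsomorphism

variable {S C : Type*} [AddCommGroup S] [Module k S] [AddCommGroup C] [Module k C]

/-- With zero differential every element of `S` represents exactly one class, so injectivity and
surjectivity on cohomology can be read off on `S` itself. -/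
theorem isQuasiIsomorphism_zero_iff (K : C →ₗ[k] C) (f : S →ₗ[k] C) :
    IsQuasiIsomorphism (0 : S →ₗ[k] S) K f ↔
      K ∘ₗ f = 0 ∧ (∀ a, f a ∈ LinearMap.range K → a = 0) ∧
        ∀ x, K x = 0 → ∃ a, x - f a ∈ LinearMap.range K := by
  have hmk : ∀ (hf : f ∘ₗ (0 : S →ₗ[k] S) = K ∘ₗ f) (a : S),
      cohomologyMap f hf (Submodule.Quotient.mk ⟨a, rfl⟩) =
        Submodule.Quotient.mk ⟨f a, by
          have := LinearMap.congr_fun hf a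
          simpa using this.symm⟩ := fun _ _ => rfl
  have hzero : ∀ a : S, (Submodule.Quotient.mk ⟨a, rfl⟩ : Cohomology (0 : S →ₗ[k] S)) = 0 ↔
      a = 0 := by
    intro a
    rw [Submodule.Quotient.mk_eq_zero]
    change a ∈ LinearMap.range (0 : S →ₗ[k] S) ↔ a = 0
    simp
  constructor
  · rintro ⟨hf, hinj, hsurj⟩
    refine ⟨by rw [← hf, LinearMap.comp_zero], fun a ha => ?_, fun x hx => ?_⟩
    · rw [← hzero]
      refine hinj ?_
      rw [hmk, map_zero, Submodule.Quotient.mk_eq_zero]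
      exact ha
    · obtain ⟨z, hz⟩ := hsurj (Submodule.Quotient.mk ⟨x, hx⟩)
      obtain ⟨⟨a, ha⟩, rfl⟩ := Submodule.Quotient.mk_surjective _ z
      refine ⟨a, ?_⟩
      have := (Submodule.Quotient.eq _).1 (hz.symm.trans (hmk hf a))
      exact this
  · rintro ⟨hf, hinj, hsurj⟩
    have hf' : f ∘ₗ (0 : S →ₗ[k] S) = K ∘ₗ f := by rw [hf, LinearMap.comp_zero]
    refine ⟨hf', ?_, ?_⟩
    · rw [injective_iff_map_eq_zero]
      intro z hz
      obtain ⟨⟨a, ha⟩, rfl⟩ := Submodule.Quotient.mk_surjective _ z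
      refine (hzero a).2 (hinj a ?_)
      exact (Submodule.Quotient.mk_eq_zero
        ((LinearMap.range K).submoduleOf (LinearMap.ker K))).1 ((hmk hf' a).symm.trans hz)
    · intro z
      obtain ⟨⟨x, hx⟩, rfl⟩ := Submodule.Quotient.mk_surjective _ z
      obtain ⟨a, ha⟩ := hsurj x hx
      refine ⟨Submodule.Quotient.mk ⟨a, rfl⟩, ?_⟩
      rw [hmk]
      exact ((Submodule.Quotient.eq
        ((LinearMap.range K).submoduleOf (LinearMap.ker K))).2 ha).symm

end QuasiIsomorphism

/-! ### The canonical homotopy probability algebra of a complete space -/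

section CompleteSpaces

theorem HomotopyProbabilityAlgebra.linearPart_descendant {V : PointedGradedSpace.{u, v} k}
    (A : HomotopyProbabilityAlgebra V) : Family.linearPart A.descendant = A.K := by
  refine linearMap_ext_homogeneous fun j x hx => ?_
  have h := A.K_onList Sigma.fst HomogeneousElement.val HomogeneousElement.val_mem
    (xs := [(⟨j, ⟨x, hx⟩⟩ : HomogeneousElement V)]) (by simp)
  simp only [select, List.map_cons, List.map_nil, add_zero, List.nil_append,
    ← Family.linearPart_apply, A.M_one, LinearMap.id_apply] at h
  exact h.symm

theorem HomotopyProbabilityAlgebra.descendant_eq_zero {V : PointedGradedSpace.{u, v} k}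
    (A : HomotopyProbabilityAlgebra V) (hK : A.K = 0) (n : ℕ) (hn : 1 ≤ n) :
    A.descendant n = 0 := by
  induction n using Nat.strong_induction_on with
  | _ n ih =>
    refine multilinearMap_ext_homogeneous fun d x hx => ?_
    rw [HomotopyProbabilityAlgebra.descendant, hK, sub_apply, ofHomogeneous_apply _ d x hx]
    have : ∀ π : OrderedFinpartition n, (∑ i : Fin π.length,
        if _h : π.partSize i < n then
          partitionSignAt d π i •
            alongPartition π (A.M π.length)
              (Function.update (fun j => idFamily V (π.partSize j)) i
                (A.descendant (π.partSize i)))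
        else 0) = 0 := by
      intro π
      refine Finset.sum_eq_zero fun i _ => ?_
      split_ifs with h
      · rw [ih _ h (π.partSize_pos i)]
        have h0 : alongPartition π (A.M π.length)
            (Function.update (fun j => idFamily V (π.partSize j)) i 0) = 0 := by
          ext y
          exact (A.M π.length).map_coord_zero i (by simp)
        rw [h0, smul_zero]
      · rfl
    simp only [this, Finset.sum_const_zero]
    simp

variable {S : PointedGradedSpace.{u, w} k} {C : PointedGradedSpace.{u, v} k}
  {A : HomotopyProbabilityAlgebra C}

theorem linearPart_correlationDensity (A : HomotopyProbabilityAlgebra C) (φ : Family S C) :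
    Family.linearPart (correlationDensity A φ) = φ.linearPart := by
  refine linearMap_ext_homogeneous fun j x hx => ?_
  have h := onList_comp Sigma.fst HomogeneousElement.val HomogeneousElement.val_mem A.M φ
    [(⟨j, ⟨x, hx⟩⟩ : HomogeneousElement S)]
  simp only [partSum, adjoin, join, List.map_cons, List.map_nil, add_zero,
    ← Family.linearPart_apply, A.M_one, LinearMap.id_apply] at h
  exact h

theorem hasDegree_linearPart {p : ℤ} {φ : Family S C} (hφ : IsSymmetricOfDegree p φ) :
    HasDegree p φ.linearPart := by
  intro j x hx
  have := hφ.mem_deg 1 le_rfl (fun _ => j) (fun _ => x) fun _ => hx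
  rwa [Fin.sum_univ_one, φ.linearPart_eq] at this

theorem K_comp_linearPart (φ : UnitalMorphism (0 : Family S S) A.descendant) :
    A.K ∘ₗ φ.toFamily.linearPart = 0 := by
  ext x
  have := congrArg (fun F => F fun _ => x) (K_correlationDensity A φ 1 le_rfl)
  simp only [LinearMap.compMultilinearMap_apply, Family.linearPart_eq] at this
  rwa [linearPart_correlationDensity] at this

/-- The correlation densities of two morphisms differ by exact elements. -/
def AreCohomologous (φ ψ : UnitalMorphism (0 : Family S S) A.descendant) : Prop :=
  ∀ (n : ℕ) (d : Fin n → ℤ) (x : Fin n → S), (∀ i, x i ∈ S.deg (d i)) →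
    correlationDensity A ψ.toFamily n x - correlationDensity A φ.toFamily n x ∈
      LinearMap.range A.K

/-- Differing by exact elements is reflexive, symmetric and transitive, so it passes from elementary
homotopies to the equivalence relation that they generate. -/
theorem areCohomologous_of_mk_eq [CharZero k]
    {φ ψ : UnitalMorphism (0 : Family S S) A.descendant}
    (h : (Quot.mk _ φ : HomotopyType (0 : Family S S) A.descendant) = Quot.mk _ ψ) :
    AreCohomologous φ ψ := by
  replace h := Quot.eqvGen_exact h
  induction h with
  | rel φ ψ h => exact h.correlationDensity_sub_mem
  | refl φ => intro n d x _; rw [sub_self]; exact zero_mem _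
  | symm φ ψ _ ih =>
    intro n d x hx
    rw [← neg_sub]
    exact neg_mem (ih n d x hx)
  | trans φ ψ χ _ _ ih1 ih2 =>
    intro n d x hx
    rw [← sub_add_sub_cancel]
    exact add_mem (ih2 n d x hx) (ih1 n d x hx)

theorem AreCohomologous.linearPart {φ ψ : UnitalMorphism (0 : Family S S) A.descendant}
    (h : AreCohomologous φ ψ) (a : S) :
    ψ.toFamily.linearPart a - φ.toFamily.linearPart a ∈ LinearMap.range A.K := by
  have key : (LinearMap.range A.K).mkQ ∘ₗ (ψ.toFamily.linearPart - φ.toFamily.linearPart) = 0 := by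
    refine linearMap_ext_homogeneous fun j x hx => ?_
    have := h 1 (fun _ => j) (fun _ => x) fun _ => hx
    rw [Family.linearPart_eq, Family.linearPart_eq, linearPart_correlationDensity,
      linearPart_correlationDensity] at this
    exact (Submodule.Quotient.mk_eq_zero _).2 this
  exact (Submodule.Quotient.mk_eq_zero _).1 (LinearMap.congr_fun key a)

/-- The cohomological criterion for `φ₁ : (S, 0) → (C, K)` to be a quasi-isomorphism. -/
theorem isQuasiIsomorphism_linearPart_iff (φ : UnitalMorphism (0 : Family S S) A.descendant) :
    IsQuasiIsomorphism (0 : S →ₗ[k] S) A.K φ.toFamily.linearPart ↔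
      (∀ a, φ.toFamily.linearPart a ∈ LinearMap.range A.K → a = 0) ∧
        ∀ x, A.K x = 0 → ∃ a, x - φ.toFamily.linearPart a ∈ LinearMap.range A.K := by
  rw [isQuasiIsomorphism_zero_iff]
  exact and_iff_right (K_comp_linearPart φ)

theorem AreCohomologous.isQuasiIsomorphism
    {φ ψ : UnitalMorphism (0 : Family S S) A.descendant} (h : AreCohomologous φ ψ)
    (hφ : IsQuasiIsomorphism (0 : S →ₗ[k] S) A.K φ.toFamily.linearPart) :
    IsQuasiIsomorphism (0 : S →ₗ[k] S) A.K ψ.toFamily.linearPart := by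
  rw [isQuasiIsomorphism_linearPart_iff] at hφ ⊢
  refine ⟨fun a ha => hφ.1 a ?_, fun x hx => ?_⟩
  · simpa using sub_mem ha (h.linearPart a)
  · obtain ⟨a, ha⟩ := hφ.2 x hx
    refine ⟨a, ?_⟩
    simpa using sub_mem ha (h.linearPart a)

theorem exists_homotopyInverse_linearPart
    (φ : UnitalMorphism (0 : Family S S) A.descendant)
    (hφ : IsQuasiIsomorphism (0 : S →ₗ[k] S) A.K φ.toFamily.linearPart) :
    ∃ D : HomotopyInverse A.K φ.toFamily.linearPart, D.β C.one = 0 := by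
  have h := (isQuasiIsomorphism_linearPart_iff φ).1 hφ
  obtain ⟨D, hD⟩ := exists_homotopyInverse A.K φ.toFamily.linearPart A.K_degree
    (hasDegree_linearPart φ.symmetric) A.K_comp_K (K_comp_linearPart φ) h.1 h.2
  -- `1_C = φ₁(1_S)` and `β` vanishes on the image under `φ₁` of degree `0`.
  exact ⟨D, by rw [← φ.map_one]; exact hD _ S.one_mem⟩

/-- The correlation functions `h ∘ Πₙ` depend neither on the representative nor on the homotopy
inverse. -/
theorem AreCohomologous.h_correlationDensity
    {φ ψ : UnitalMorphism (0 : Family S S) A.descendant} (h : AreCohomologous φ ψ)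
    (D : HomotopyInverse A.K φ.toFamily.linearPart)
    (D' : HomotopyInverse A.K ψ.toFamily.linearPart) (n : ℕ) (hn : 1 ≤ n) :
    D.h.compMultilinearMap (correlationDensity A φ.toFamily n) =
      D'.h.compMultilinearMap (correlationDensity A ψ.toFamily n) := by
  refine multilinearMap_ext_homogeneous fun d x hx => ?_
  obtain ⟨y, hy⟩ := h n d x hx
  have h1 := congrArg D.h hy
  rw [← LinearMap.comp_apply, D.h_comp_K, map_sub, LinearMap.zero_apply] at h1
  have h2 := D.h_eq D' h.linearPart
    (congrArg (fun F => F x) (K_correlationDensity A ψ n hn))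
  exact (sub_eq_zero.1 h1.symm).symm.trans h2

theorem correlationDensity_appendOne (A : HomotopyProbabilityAlgebra C)
    (φ : UnitalMorphism (0 : Family S S) A.descendant) (n : ℕ) (hn : 1 ≤ n) (x : Fin n → S) :
    correlationDensity A φ.toFamily (n + 1) (appendOne x) =
      correlationDensity A φ.toFamily n x :=
  comp_appendOne A.M_unit φ.map_one φ.map_unit hn x

theorem linearPart_compMultilinearMap {E : PointedGradedSpace.{u, w'} k} (h : C →ₗ[k] E)
    (f : Family S C) :
    Family.linearPart (fun n => h.compMultilinearMap (f n)) = h ∘ₗ f.linearPart := rfl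

/-- The homotopy probability algebra with zero differential defined by a homotopy inverse. -/
def cohomologyAlgebra (φ : UnitalMorphism (0 : Family S S) A.descendant)
    (D : HomotopyInverse A.K φ.toFamily.linearPart) : HomotopyProbabilityAlgebra S where
  M n := D.h.compMultilinearMap (correlationDensity A φ.toFamily n)
  symmetric := (A.symmetric.comp φ.symmetric).compLinear D.h_degree
  M_one := by
    rw [linearPart_compMultilinearMap, linearPart_correlationDensity, D.h_comp_f]
  M_unit n hn x := congrArg D.h (correlationDensity_appendOne A φ n hn x)
  K := 0
  K_degree j x _ := zero_mem _
  K_comp_K := by simp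
  K_unit := rfl
  -- With zero differential this says `1_S ≠ 0`; otherwise `1_C = φ₁(0) = 0` would be exact in `C`.
  unit_not_exact := by
    rw [LinearMap.range_zero, Submodule.mem_bot]
    intro h
    refine A.unit_not_exact ?_
    rw [← φ.map_one, h, map_zero]
    exact zero_mem _

/-- A morphism is the descendant, up to `β ∘ Π`, of the linear part of any cohomologous one. -/
theorem AreCohomologous.isDescendantMorphism
    {φ ψ : UnitalMorphism (0 : Family S S) A.descendant} (h : AreCohomologous φ ψ)
    (D : HomotopyInverse A.K φ.toFamily.linearPart) (hD : D.β C.one = 0)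
    (B : HomotopyProbabilityAlgebra S) (hB : B.K = 0)
    (hM : ∀ n : ℕ, 1 ≤ n →
      B.M n = D.h.compMultilinearMap (correlationDensity A φ.toFamily n))
    (hf : IsMorphism B A φ.toFamily.linearPart) :
    IsDescendantMorphism B A φ.toFamily.linearPart
      (fun n => D.β.compMultilinearMap (correlationDensity A ψ.toFamily n)) ψ.toFamily where
  isMorphism := hf
  isDescentHomotopy :=
    { symmetric := (A.symmetric.comp ψ.symmetric).compLinear D.β_degree
      map_one := by
        rw [linearPart_compMultilinearMap, linearPart_correlationDensity, LinearMap.comp_apply,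
          ψ.map_one, hD]
      map_unit := fun n hn x => congrArg D.β (correlationDensity_appendOne A ψ n hn x) }
  relation n hn := by
    rw [insertion_eq_zero _ _ (B.descendant_eq_zero hB), add_zero, hM n hn]
    refine multilinearMap_ext_homogeneous fun d x hx => ?_
    obtain ⟨y, hy⟩ := h n d x hx
    have h1 := congrArg D.h hy
    rw [← LinearMap.comp_apply, D.h_comp_K, map_sub, LinearMap.zero_apply] at h1
    -- `φ₁ h = I + K β + β K` on the closed density of `ψ`; the term `β K` drops out, and `h` takes
    -- the same value on the densities of `φ` and `ψ`.
    have h2 := LinearMap.congr_fun D.f_comp_h (correlationDensity A ψ.toFamily n x)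
    have h3 : A.K (correlationDensity A ψ.toFamily n x) = 0 :=
      congrArg (fun F => F x) (K_correlationDensity A ψ n hn)
    simp only [LinearMap.comp_apply, LinearMap.add_apply, LinearMap.id_apply, h3, map_zero,
      add_zero, sub_eq_zero.1 h1.symm] at h2
    exact h2

end CompleteSpaces

end

end HomotopyProbability

theorem mainTheorem6 {k : Type u} [Field k] [CharZero k]
    {C : HomotopyProbability.PointedGradedSpace.{u, v} k}
    (A : HomotopyProbability.HomotopyProbabilityAlgebra C)
    (S : HomotopyProbability.CompleteSpace.{u, v, w} A) :
    -- every representative has a linear part with a homotopy inverse whose `β` kills the unit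
    (∀ φ, S.Represents φ →
      ∃ D : HomotopyProbability.HomotopyInverse A.K φ.toFamily.linearPart, D.β C.one = 0) ∧
    -- the canonical homotopy probability algebra with zero differential
    ∃ B : HomotopyProbability.HomotopyProbabilityAlgebra S.space,
      B.K = 0 ∧
      -- its products are `h ∘ Πₙ`, whatever the representative and the homotopy inverse
      (∀ φ, S.Represents φ →
        ∀ D : HomotopyProbability.HomotopyInverse A.K φ.toFamily.linearPart,
          ∀ n : ℕ, 1 ≤ n →
            B.M n = D.h.compMultilinearMap
              (HomotopyProbability.correlationDensity A φ.toFamily n)) ∧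
      -- the first component of every representative is a quasi-isomorphism to `(C, M, K)`
      (∀ φ, S.Represents φ →
        HomotopyProbability.IsMorphism B A φ.toFamily.linearPart ∧
        HomotopyProbability.IsQuasiIsomorphism B.K A.K φ.toFamily.linearPart) ∧
      -- the descendant is `(S, 1_S, 0)`
      (∀ n : ℕ, 1 ≤ n → B.descendant n = 0) ∧
      -- every representative is the descendant of its first component up to `β ∘ Πₙ`
      (∀ φ, S.Represents φ →
        ∀ D : HomotopyProbability.HomotopyInverse A.K φ.toFamily.linearPart, D.β C.one = 0 →
          HomotopyProbability.IsDescendantMorphism B A φ.toFamily.linearPart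
            (fun n => D.β.compMultilinearMap
              (HomotopyProbability.correlationDensity A φ.toFamily n)) φ.toFamily) ∧
      -- all representatives are descendants of the first component of any given one
      (∀ φ ψ, S.Represents φ → S.Represents ψ →
        ∃ Λ : HomotopyProbability.Family S.space C,
          HomotopyProbability.IsDescendantMorphism B A φ.toFamily.linearPart Λ ψ.toFamily) := by
  have hrep : ∀ φ ψ, S.Represents φ → S.Represents ψ →
      HomotopyProbability.AreCohomologous φ ψ := fun φ ψ hφ hψ =>
    HomotopyProbability.areCohomologous_of_mk_eq (hφ.trans hψ.symm)
  obtain ⟨φ₀, hφ₀, hq₀⟩ := S.exists_quasiIso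
  rw [HomotopyProbability.HomotopyProbabilityAlgebra.linearPart_descendant] at hq₀
  have hquasi : ∀ φ, S.Represents φ → HomotopyProbability.IsQuasiIsomorphism
      (0 : S.space →ₗ[k] S.space) A.K φ.toFamily.linearPart :=
    fun φ hφ => (hrep φ₀ φ hφ₀ hφ).isQuasiIsomorphism hq₀
  have hinv : ∀ φ, S.Represents φ →
      ∃ D : HomotopyProbability.HomotopyInverse A.K φ.toFamily.linearPart, D.β C.one = 0 :=
    fun φ hφ => HomotopyProbability.exists_homotopyInverse_linearPart φ (hquasi φ hφ)
  obtain ⟨D₀, -⟩ := hinv φ₀ hφ₀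
  -- The structure is built from one arbitrary choice; `hM` shows that it does not depend on the
  -- choice.
  let B := HomotopyProbability.cohomologyAlgebra φ₀ D₀
  have hM : ∀ φ, S.Represents φ →
      ∀ D : HomotopyProbability.HomotopyInverse A.K φ.toFamily.linearPart,
        ∀ n : ℕ, 1 ≤ n → B.M n = D.h.compMultilinearMap
          (HomotopyProbability.correlationDensity A φ.toFamily n) :=
    fun φ hφ D n hn => (hrep φ₀ φ hφ₀ hφ).h_correlationDensity D₀ D n hn
  have hmor : ∀ φ, S.Represents φ →
      HomotopyProbability.IsMorphism B A φ.toFamily.linearPart := fun φ _ =>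
    ⟨HomotopyProbability.hasDegree_linearPart φ.symmetric,
      (LinearMap.comp_zero _).trans (HomotopyProbability.K_comp_linearPart φ).symm, φ.map_one⟩
  -- Allowing `ψ` to differ from `φ` covers both claims about descendants: `ψ = φ` with a prescribed
  -- `D`, and arbitrary `ψ` with any `D` killing the unit.
  have hdesc : ∀ φ ψ, S.Represents φ → S.Represents ψ →
      ∀ D : HomotopyProbability.HomotopyInverse A.K φ.toFamily.linearPart, D.β C.one = 0 →
        HomotopyProbability.IsDescendantMorphism B A φ.toFamily.linearPart
          (fun n => D.β.compMultilinearMap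
            (HomotopyProbability.correlationDensity A ψ.toFamily n)) ψ.toFamily :=
    fun φ ψ hφ hψ D hD =>
      (hrep φ ψ hφ hψ).isDescendantMorphism D hD B rfl (hM φ hφ D) (hmor φ hφ)
  refine ⟨hinv, B, rfl, hM, fun φ hφ => ⟨hmor φ hφ, hquasi φ hφ⟩, B.descendant_eq_zero rfl,
    fun φ hφ D hD => hdesc φ φ hφ hφ D hD, fun φ ψ hφ hψ => ?_⟩
  obtain ⟨D, hD⟩ := hinv φ hφ
  exact ⟨_, hdesc φ ψ hφ hψ D hD⟩
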